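/- Let $n>1$, let $k$ be a field of characteristic $0$ containing a primitive $n$-th root of unity $\zeta$, and let $H_n$ be the Taft Hopf algebra: the $k$-algebra with generators $K,X$ and relations $KX=\zeta XK$, $K^n=1$, $X^n=0$, with comultiplication $\Delta(K)=K\otimes K$, $\Delta(X)=X\otimes 1+K\otimes X$, counit $\epsilon(K)=1$, $\epsilon(X)=0$, and antipode $S(K)=K^{-1}$, $S(X)=-K^{-1}X$. Let $\Lambda\in H_n$ be any left integral, that is, a nonzero element with $h\Lambda=\epsilon(h)\Lambda$ for all $h\in H_n$. Let $H_n\text{-}\underline{\mathrm{mod}}$ be the stable category of finite-dimensional left $H_n$-modules, that is, the category of these modules with homomorphisms taken modulo those that factor through a projective (equivalently, injective) module. Put $TM=(H_n/k\Lambda)\otimes M$. For a module homomorphism $u\colon X\to Y$ let $C_u$ be the pushout of $u$ and of $X\to H_n\otimes X$, $x\mapsto\Lambda\otimes x$; the distinguished triangles are those isomorphic in $H_n\text{-}\underline{\mathrm{mod}}$ to a standard triangle $X\xrightarrow{u} Y\to C_u\to TX$. Let $K(H_n\text{-}\underline{\mathrm{mod}})$ be the Grothendieck group: the abelian group with generators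 $[X]$ for all objects $X$ and relations $[Y]=[X]+[Z]$ for all distinguished triangles $X\to Y\to Z\to TX$. Then $K(H_n\text{-}\underline{\mathrm{mod}})$ has a unique ring structure with the given addition in which $[M][N]=[M\otimes N]$ for all finite-dimensional modules $M,N$ and $1$ is the class of the trivial module $k$; and with this ring structure it is isomorphic, as a ring, to $$R_n=\mathbb Z[q]/(1+q+\dots+q^{n-1}).$$ -/

import Mathlib

open CategoryTheory TensorProduct Coalgebra

universe u

/-! ## Finite-dimensional modules over a finite-dimensional algebra or bialgebra -/

/-- A finite-dimensional left module over the `k`-algebra `H`, given as a finite-dimensional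
`k`-vector space together with an algebra homomorphism `ρ : H → End_k(V)`. -/
structure FDMod (k H : Type u) [Field k] [Ring H] [Algebra k H] where
  carrier : Type u
  [addCommGroup : AddCommGroup carrier]
  [module : Module k carrier]
  [finite : Module.Finite k carrier]
  ρ : H →ₐ[k] Module.End k carrier

namespace FDMod

attribute [instance] FDMod.addCommGroup FDMod.module FDMod.finite

section Algebra

variable {k H : Type u} [Field k] [Ring H] [Algebra k H]

/-- Homomorphisms of `H`-modules. -/
@[ext]
structure Hom (X Y : FDMod k H) where
  toLin : X.carrier →ₗ[k] Y.carrier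
  comm : ∀ (h : H) (x : X.carrier), toLin (X.ρ h x) = Y.ρ h (toLin x)

/-- The category `H`-mod of finite-dimensional left `H`-modules. -/
instance : Category.{u} (FDMod k H) where
  Hom X Y := Hom X Y
  id X := ⟨LinearMap.id, fun _ _ => rfl⟩
  comp f g := ⟨g.toLin ∘ₗ f.toLin, fun h x => by simp [f.comm, g.comm]⟩

/-- `P` is projective as a module over the ring `H`. -/
def IsProjective (P : FDMod k H) : Prop :=
  @Module.Projective H _ P.carrier _ (Module.compHom P.carrier P.ρ.toRingHom)

/-- The regular module `H`. -/
noncomputable def reg (k H : Type u) [Field k] [Ring H] [Algebra k H] [Module.Finite k H] :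
    FDMod k H where
  carrier := H
  ρ := Algebra.lmul k H

/-- The direct sum `X ⊕ Y`. -/
noncomputable def prod (X Y : FDMod k H) : FDMod k H where
  carrier := X.carrier × Y.carrier
  ρ := AlgHom.ofLinearMap
    { toFun := fun h => (X.ρ h).prodMap (Y.ρ h)
      map_add' := fun a b => by ext <;> simp
      map_smul' := fun c a => by ext <;> simp }
    (by ext <;> simp)
    (fun a b => by ext <;> simp)

/-- The cokernel `Y / f(X)` of a homomorphism of modules. -/
noncomputable def coker {X Y : FDMod k H} (f : X ⟶ Y) : FDMod k H where
  carrier := Y.carrier ⧸ LinearMap.range (Hom.toLin f)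
  ρ := AlgHom.ofLinearMap
    { toFun := fun h => (LinearMap.range (Hom.toLin f)).mapQ (LinearMap.range (Hom.toLin f))
        (Y.ρ h) (by rintro _ ⟨x, rfl⟩; exact ⟨X.ρ h x, Hom.comm f h x⟩)
      map_add' := fun a b => by ext; simp
      map_smul' := fun c a => by ext; simp }
    (by ext; simp)
    (fun a b => by ext; simp)

/-- The projection `Y → Y / f(X)`. -/
noncomputable def cokerMk {X Y : FDMod k H} (f : X ⟶ Y) : Y ⟶ coker f where
  toLin := (LinearMap.range (Hom.toLin f)).mkQ
  comm _ _ := rfl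

/-- A homomorphism out of `Y` that kills `f(X)` descends to `Y / f(X)`. -/
noncomputable def cokerDesc {X Y Z : FDMod k H} (f : X ⟶ Y) (g : Y ⟶ Z)
    (w : ∀ x : X.carrier, Hom.toLin g (Hom.toLin f x) = 0) : coker f ⟶ Z where
  toLin := (LinearMap.range (Hom.toLin f)).liftQ (Hom.toLin g)
    (by rintro _ ⟨x, rfl⟩; exact w x)
  comm h x := by
    obtain ⟨y, rfl⟩ := Submodule.Quotient.mk_surjective _ x
    exact Hom.comm g h y

/-- Two homomorphisms `f, g : X → Y` are identified in the stable category when their difference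
factors through a projective module. -/
def stableRel (k H : Type u) [Field k] [Ring H] [Algebra k H] : HomRel (FDMod k H) :=
  fun X Y f g => ∃ (P : FDMod k H) (a : X ⟶ P) (b : P ⟶ Y), P.IsProjective ∧
    Hom.toLin f - Hom.toLin g = Hom.toLin (a ≫ b)

end Algebra

section Bialgebra

variable {k H : Type u} [Field k] [Ring H] [Bialgebra k H]

/-- The unit object: the ground field, on which `H` acts through the counit. -/
noncomputable def unit (k H : Type u) [Field k] [Ring H] [Bialgebra k H] : FDMod k H where
  carrier := k
  ρ := (Algebra.lmul k k).comp (Bialgebra.counitAlgHom k H)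

/-- The action of `H ⊗ H` on the vector space `X ⊗ Y`. -/
noncomputable def tensorAct (X Y : FDMod k H) :
    H ⊗[k] H →ₐ[k] Module.End k (X.carrier ⊗[k] Y.carrier) :=
  (Module.endTensorEndAlgHom (R := k) (S := k) (A := k)).comp
    (Algebra.TensorProduct.map X.ρ Y.ρ)

@[simp]
theorem tensorAct_tmul (X Y : FDMod k H) (a b : H) (x : X.carrier) (y : Y.carrier) :
    tensorAct X Y (a ⊗ₜ b) (x ⊗ₜ y) = X.ρ a x ⊗ₜ Y.ρ b y := rfl

/-- The tensor product over `k`, on which `H` acts through the comultiplication. -/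
noncomputable def tensor (X Y : FDMod k H) : FDMod k H where
  carrier := X.carrier ⊗[k] Y.carrier
  ρ := (tensorAct X Y).comp (Bialgebra.comulAlgHom k H)

theorem tensorAct_map {X X' Y Y' : FDMod k H} (f : X ⟶ X') (g : Y ⟶ Y') (t : H ⊗[k] H)
    (z : X.carrier ⊗[k] Y.carrier) :
    TensorProduct.map (Hom.toLin f) (Hom.toLin g) (tensorAct X Y t z) =
      tensorAct X' Y' t (TensorProduct.map (Hom.toLin f) (Hom.toLin g) z) := by
  induction t using TensorProduct.induction_on with
  | zero => simp
  | add a b ha hb => simp only [map_add, LinearMap.add_apply, ha, hb]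
  | tmul a b =>
    induction z using TensorProduct.induction_on with
    | zero => simp
    | add x y hx hy => simp only [map_add, hx, hy]
    | tmul x y => simp [Hom.comm]

/-- The tensor product of homomorphisms. -/
noncomputable def tensorHom {X X' Y Y' : FDMod k H} (f : X ⟶ X') (g : Y ⟶ Y') :
    tensor X Y ⟶ tensor X' Y' where
  toLin := TensorProduct.map (Hom.toLin f) (Hom.toLin g)
  comm h z := tensorAct_map f g (comul (R := k) h) z

end Bialgebra

end FDMod

/-! ## The stable category of a finite-dimensional Hopf algebra and its Grothendieck group -/

/-- A left integral of the Hopf algebra `H`: a nonzero `Λ` with `hΛ = ε(h)Λ` for all `h`. -/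
structure LeftIntegral (k H : Type u) [Field k] [Ring H] [HopfAlgebra k H] where
  elem : H
  ne_zero : elem ≠ 0
  mul_elem : ∀ h : H, h * elem = counit (R := k) h • elem

/-- The stable category: finite-dimensional `H`-modules, with homomorphisms taken modulo those
that factor through a projective (equivalently, injective) module. -/
abbrev StMod (k H : Type u) [Field k] [Ring H] [HopfAlgebra k H] :=
  CategoryTheory.Quotient (FDMod.stableRel k H)

namespace StMod

open FDMod

section

variable {k H : Type u} [Field k] [Ring H] [HopfAlgebra k H]

/-- A module, viewed as an object of the stable category. -/
abbrev of (X : FDMod k H) : StMod k H := ⟨X⟩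

/-- The class in the stable category of a homomorphism of modules. -/
abbrev res {X Y : FDMod k H} (f : X ⟶ Y) : of X ⟶ of Y :=
  (CategoryTheory.Quotient.functor (stableRel k H)).map f

end

variable {k H : Type u} [Field k] [Ring H] [HopfAlgebra k H] [Module.Finite k H]
variable (Λ : LeftIntegral k H)

/-- The integral `Λ`, viewed as an element of the regular module. -/
def vec : (reg k H).carrier := Λ.elem

theorem act_vec (h : H) : (reg k H).ρ h (vec Λ) = counit (R := k) h • vec Λ := Λ.mul_elem h

/-- The embedding `k → H`, `c ↦ cΛ`, of the trivial module. -/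
noncomputable def integralHom : unit k H ⟶ reg k H where
  toLin := LinearMap.toSpanSingleton k (reg k H).carrier (vec Λ)
  comm h (c : k) := by
    change (counit (R := k) h * c) • vec Λ = (reg k H).ρ h (c • vec Λ)
    rw [map_smul, act_vec, smul_smul, mul_comm]

theorem tensorAct_integral (X : FDMod k H) (t : H ⊗[k] H) (x : X.carrier) :
    tensorAct (reg k H) X t (vec Λ ⊗ₜ[k] x) =
      vec Λ ⊗ₜ[k] X.ρ (TensorProduct.lid k H ((counit (R := k)).rTensor H t)) x := by
  induction t using TensorProduct.induction_on with
  | zero => simp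
  | add a b ha hb => simp only [map_add, LinearMap.add_apply, ha, hb, TensorProduct.tmul_add]
  | tmul a b =>
    simp [act_vec, TensorProduct.smul_tmul]

/-- The embedding `X → H ⊗ X`, `x ↦ Λ ⊗ x`. -/
noncomputable def embed (X : FDMod k H) : X ⟶ tensor (reg k H) X where
  toLin := TensorProduct.mk k (reg k H).carrier X.carrier (vec Λ)
  comm h x := by
    have := tensorAct_integral Λ X (comul (R := k) h) x
    rw [Coalgebra.rTensor_counit_comul, TensorProduct.lid_tmul, one_smul] at this
    exact this.symm

/-- The shift `T X = (H / kΛ) ⊗ X`. -/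
noncomputable def shift (X : FDMod k H) : FDMod k H := tensor (coker (integralHom Λ)) X

/-- The shift of a homomorphism of modules. -/
noncomputable def shiftMap {X Y : FDMod k H} (f : X ⟶ Y) : shift Λ X ⟶ shift Λ Y :=
  tensorHom (𝟙 _) f

/-- The homomorphism `X → Y ⊕ (H ⊗ X)`, `x ↦ (u x, - Λ ⊗ x)`, whose cokernel is the pushout
of `u : X → Y` and `X → H ⊗ X`. -/
noncomputable def pushoutHom {X Y : FDMod k H} (u : X ⟶ Y) :
    X ⟶ FDMod.prod Y (tensor (reg k H) X) where
  toLin := (Hom.toLin u).prod (-(Hom.toLin (embed Λ X)))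
  comm h x := Prod.ext (Hom.comm u h x)
    ((congrArg Neg.neg (Hom.comm (embed Λ X) h x)).trans (map_neg _ _).symm)

/-- The cone of `u : X → Y`: the pushout of `u` and the embedding `X → H ⊗ X`. -/
noncomputable def cone {X Y : FDMod k H} (u : X ⟶ Y) : FDMod k H := coker (pushoutHom Λ u)

/-- The homomorphism `v : Y → C_u`. -/
noncomputable def coneIn {X Y : FDMod k H} (u : X ⟶ Y) : Y ⟶ cone Λ u where
  toLin := Hom.toLin (cokerMk (pushoutHom Λ u)) ∘ₗ
    LinearMap.inl k Y.carrier (tensor (reg k H) X).carrier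
  comm h y := by
    refine Eq.trans (congrArg (Hom.toLin (cokerMk (pushoutHom Λ u))) ?_)
      (Hom.comm (cokerMk (pushoutHom Λ u)) h (y, 0))
    exact Prod.ext rfl (map_zero ((tensor (reg k H) X).ρ h)).symm

/-- The homomorphism `Y ⊕ (H ⊗ X) → T X`, `(y, h ⊗ x) ↦ [h] ⊗ x`. -/
noncomputable def prodToShift (X Y : FDMod k H) :
    FDMod.prod Y (tensor (reg k H) X) ⟶ shift Λ X where
  toLin := Hom.toLin (tensorHom (cokerMk (integralHom Λ)) (𝟙 X)) ∘ₗ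
    LinearMap.snd k Y.carrier (tensor (reg k H) X).carrier
  comm h z := Hom.comm (tensorHom (cokerMk (integralHom Λ)) (𝟙 X)) h z.2

/-- The homomorphism `w : C_u → T X`. -/
noncomputable def coneOut {X Y : FDMod k H} (u : X ⟶ Y) : cone Λ u ⟶ shift Λ X :=
  cokerDesc (pushoutHom Λ u) (prodToShift Λ X Y) (by
    intro x
    change TensorProduct.map _ _ (-(vec Λ ⊗ₜ[k] x)) = _
    rw [map_neg, TensorProduct.map_tmul]
    have : Hom.toLin (cokerMk (integralHom Λ)) (vec Λ) = 0 :=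
      (Submodule.Quotient.mk_eq_zero _).2 ⟨(1 : k), one_smul k (vec Λ)⟩
    rw [this, TensorProduct.zero_tmul, neg_zero]
    rfl)

/-- Distinguished triangles `X → Y → Z → T X` in the stable category: those isomorphic in the
stable category to the standard triangle `X' → Y' → C_u → T X'` of a homomorphism `u` of modules.
The shift of a morphism `a` of the stable category is the class of `shiftMap` of a homomorphism
representing it; so the first component of the isomorphism is given by a representative. -/
def IsDistinguished {X Y Z : StMod k H} (f : X ⟶ Y) (g : Y ⟶ Z) (h : Z ⟶ of (shift Λ X.as)) :
    Prop :=
  ∃ (X' Y' : FDMod k H) (u : X' ⟶ Y') (a : X.as ⟶ X') (b : Y ≅ of Y') (c : Z ≅ of (cone Λ u)),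
    IsIso (res a) ∧
    f ≫ b.hom = (res a : X ⟶ of X') ≫ res u ∧
    g ≫ c.hom = b.hom ≫ res (coneIn Λ u) ∧
    h ≫ res (shiftMap Λ a) = c.hom ≫ res (coneOut Λ u)

/-- The Grothendieck group of the stable category: generators `[X]` for all objects `X`, relations
`[Y] = [X] + [Z]` for all distinguished triangles `X → Y → Z → T X`. -/
def GrothendieckGroup : Type (u + 1) :=
  FreeAbelianGroup (StMod k H) ⧸ AddSubgroup.closure
    {r : FreeAbelianGroup (StMod k H) |
      ∃ (X Y Z : StMod k H) (f : X ⟶ Y) (g : Y ⟶ Z) (h : Z ⟶ of (shift Λ X.as)),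
        IsDistinguished Λ f g h ∧
        r = FreeAbelianGroup.of Y - (FreeAbelianGroup.of X + FreeAbelianGroup.of Z)}

noncomputable instance groupStructure : AddCommGroup (GrothendieckGroup Λ) :=
  inferInstanceAs (AddCommGroup (FreeAbelianGroup (StMod k H) ⧸ AddSubgroup.closure _))

/-- The class `[X]` in the Grothendieck group. -/
def cls (X : StMod k H) : GrothendieckGroup Λ :=
  QuotientAddGroup.mk (FreeAbelianGroup.of X)

/-- The ring structure `r` on the set underlying the Grothendieck group is that of the
Grothendieck ring: it has the given addition, `1 = [𝟏]` is the class of the unit object, and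
`[X][Y] = [X ⊗ Y]`. -/
structure IsGrothendieckRing (r : Ring (GrothendieckGroup Λ)) : Prop where
  add_eq : ∀ x y : GrothendieckGroup Λ, r.add x y = (groupStructure Λ).add x y
  one_eq : r.one = cls Λ (of (unit k H))
  mul_eq : ∀ X Y : FDMod k H,
    r.mul (cls Λ (of X)) (cls Λ (of Y)) = cls Λ (of (tensor X Y))

end StMod

/-! ## The Taft Hopf algebra -/

namespace Taft

/-- The generators `K`, `X`. -/
inductive Gen
  | K
  | X

/-- The relations `KX = ζXK`, `K^n = 1`, `X^n = 0`. -/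
inductive Rel {k : Type u} [Field k] (n : ℕ) (ζ : k) :
    FreeAlgebra k Gen → FreeAlgebra k Gen → Prop
  | comm : Rel n ζ (FreeAlgebra.ι k Gen.K * FreeAlgebra.ι k Gen.X)
      (ζ • (FreeAlgebra.ι k Gen.X * FreeAlgebra.ι k Gen.K))
  | pow_K : Rel n ζ (FreeAlgebra.ι k Gen.K ^ n) 1
  | pow_X : Rel n ζ (FreeAlgebra.ι k Gen.X ^ n) 0

end Taft

/-- The Taft algebra `H_n`: the `k`-algebra with generators `K`, `X` and relations `KX = ζXK`,
`K^n = 1`, `X^n = 0`, where `ζ` is a primitive `n`-th root of unity and `n > 1`. -/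
def TaftAlgebra {k : Type u} [Field k] {n : ℕ} {ζ : k} (_hn : 1 < n)
    (_hζ : IsPrimitiveRoot ζ n) : Type u :=
  RingQuot (Taft.Rel n ζ)

namespace Taft

section qBinomial

variable {k : Type u} [Field k]

/-- The `q`-binomial coefficients, by their Pascal rule. -/
def qBinom (q : k) : ℕ → ℕ → k
  | 0, 0 => 1
  | 0, _ + 1 => 0
  | _ + 1, 0 => 1
  | m + 1, j + 1 => qBinom q m j + q ^ (j + 1) * qBinom q m (j + 1)

theorem qBinom_zero_right (q : k) (m : ℕ) : qBinom q m 0 = 1 := by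
  cases m <;> rfl

theorem qBinom_eq_zero (q : k) (m : ℕ) : ∀ j, m < j → qBinom q m j = 0 := by
  induction m with
  | zero => rintro (_ | j) h; · omega
            rfl
  | succ m ih =>
    rintro (_ | j) h
    · omega
    · rw [qBinom, ih j (by omega), ih (j + 1) (by omega)]; simp

theorem qBinom_self (q : k) (m : ℕ) : qBinom q m m = 1 := by
  induction m with
  | zero => rfl
  | succ m ih => rw [qBinom, ih, qBinom_eq_zero q m (m + 1) (by omega)]; simp

/-- The `q`-integer `1 + q + ⋯ + q^(m-1)`. -/
def qInt (q : k) (m : ℕ) : k := ∑ i ∈ Finset.range m, q ^ i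

/-- The `q`-factorial. -/
def qFact (q : k) (m : ℕ) : k := ∏ i ∈ Finset.range m, qInt q (i + 1)

theorem qInt_add (q : k) (a b : ℕ) : qInt q (a + b) = qInt q a + q ^ a * qInt q b := by
  simp only [qInt, Finset.sum_range_add, pow_add, Finset.mul_sum]

theorem qFact_succ (q : k) (m : ℕ) : qFact q (m + 1) = qInt q (m + 1) * qFact q m := by
  rw [qFact, Finset.prod_range_succ, mul_comm]; rfl

theorem qBinom_mul_qFact (q : k) (m : ℕ) : ∀ i j, i + j = m →
    qBinom q m i * (qFact q i * qFact q j) = qFact q m := by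
  induction m with
  | zero =>
    intro i j h
    obtain ⟨rfl, rfl⟩ : i = 0 ∧ j = 0 := by omega
    simp [qBinom, qFact]
  | succ m ih =>
    rintro (_ | i) j h
    · obtain rfl : j = m + 1 := by omega
      simp [qBinom, qFact]
    · rcases j with _ | j
      · obtain rfl : i = m := by omega
        rw [qBinom_self]; simp [qFact]
      · have h1 := ih i (j + 1) (by omega)
        have h2 := ih (i + 1) j (by omega)
        have h3 : qInt q (m + 1) = qInt q (i + 1) + q ^ (i + 1) * qInt q (j + 1) := by
          rw [← qInt_add]; congr 1; omega
        rw [qFact_succ q m, qBinom, h3]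
        rw [qFact_succ q j] at h1 ⊢
        rw [qFact_succ q i] at h2 ⊢
        linear_combination (qInt q (i + 1)) * h1 + (q ^ (i + 1) * qInt q (j + 1)) * h2

theorem qInt_ne_zero {n : ℕ} {ζ : k} (hζ : IsPrimitiveRoot ζ n) {m : ℕ} (h0 : 0 < m)
    (hm : m < n) : qInt ζ m ≠ 0 := by
  intro h
  have h1 : qInt ζ m * (ζ - 1) = ζ ^ m - 1 := geom_sum_mul ζ m
  rw [h, zero_mul, eq_comm, sub_eq_zero] at h1
  exact hζ.pow_ne_one_of_pos_of_lt h0.ne' hm h1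

theorem qBinom_root {n : ℕ} {ζ : k} (hn : 1 < n) (hζ : IsPrimitiveRoot ζ n) {j : ℕ}
    (h0 : 0 < j) (hj : j < n) : qBinom ζ n j = 0 := by
  have h := qBinom_mul_qFact ζ n j (n - j) (by omega)
  have hz : qFact ζ n = 0 :=
    Finset.prod_eq_zero (Finset.mem_range.2 (show n - 1 < n by omega))
      (by rw [Nat.sub_add_cancel hn.le]; exact hζ.geom_sum_eq_zero hn)
  have hne : ∀ m, m < n → qFact ζ m ≠ 0 := fun m hm =>
    Finset.prod_ne_zero_iff.2 fun i hi =>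
      qInt_ne_zero hζ (by omega) (by have := Finset.mem_range.1 hi; omega)
  rw [hz] at h
  exact (mul_eq_zero.1 h).resolve_right (mul_ne_zero (hne j hj) (hne _ (by omega)))

/-- The `q`-binomial formula for `ba = q ab`. -/
theorem add_pow_q {A : Type*} [Ring A] [Algebra k A] (q : k) (a b : A)
    (h : b * a = q • (a * b)) (m : ℕ) :
    (a + b) ^ m = ∑ j ∈ Finset.range (m + 1), qBinom q m j • (a ^ j * b ^ (m - j)) := by
  have hb : ∀ j, b * a ^ j = q ^ j • (a ^ j * b) := by
    intro j
    induction j with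
    | zero => simp
    | succ j ih =>
      rw [pow_succ, ← mul_assoc, ih, smul_mul_assoc, mul_assoc, h, mul_smul_comm, smul_smul,
        ← pow_succ, mul_assoc]
  induction m with
  | zero => simp [qBinom]
  | succ m ih =>
    rw [pow_succ', ih, add_mul, Finset.mul_sum, Finset.mul_sum, Finset.sum_range_succ' _ (m + 1)]
    have e1 : ∑ j ∈ Finset.range (m + 1), a * qBinom q m j • (a ^ j * b ^ (m - j)) =
        ∑ j ∈ Finset.range (m + 1), qBinom q m j • (a ^ (j + 1) * b ^ (m - j)) :=
      Finset.sum_congr rfl fun j _ => by rw [mul_smul_comm, ← mul_assoc, ← pow_succ']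
    have e2 : ∑ j ∈ Finset.range (m + 1), b * qBinom q m j • (a ^ j * b ^ (m - j)) =
        ∑ j ∈ Finset.range (m + 1),
          (q ^ j * qBinom q m j) • (a ^ j * b ^ (m + 1 - j)) :=
      Finset.sum_congr rfl fun j hj => by
        have : j ≤ m := by have := Finset.mem_range.1 hj; omega
        rw [mul_smul_comm, ← mul_assoc, hb, smul_mul_assoc, smul_smul, mul_assoc, ← pow_succ',
          mul_comm, Nat.sub_add_comm this]
    have e3 : ∑ j ∈ Finset.range (m + 1),
          (q ^ j * qBinom q m j) • (a ^ j * b ^ (m + 1 - j)) =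
        ∑ j ∈ Finset.range (m + 1),
          (q ^ (j + 1) * qBinom q m (j + 1)) • (a ^ (j + 1) * b ^ (m - j)) + b ^ (m + 1) := by
      rw [Finset.sum_range_succ', Finset.sum_range_succ _ m, qBinom_eq_zero q m (m + 1) (by omega)]
      simp [qBinom_zero_right]
    rw [e1, e2, e3, ← add_assoc, ← Finset.sum_add_distrib]
    congr 1
    · refine Finset.sum_congr rfl fun j _ => ?_
      rw [qBinom, add_smul, Nat.add_sub_add_right]
    · simp [qBinom]

theorem add_pow_root {A : Type*} [Ring A] [Algebra k A] {n : ℕ} {ζ : k} (hn : 1 < n)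
    (hζ : IsPrimitiveRoot ζ n) (a b : A) (h : b * a = ζ • (a * b)) :
    (a + b) ^ n = a ^ n + b ^ n := by
  obtain ⟨m, rfl⟩ : ∃ m, n = m + 1 := ⟨n - 1, by omega⟩
  rw [add_pow_q ζ a b h, Finset.sum_range_succ, Finset.sum_range_succ',
    Finset.sum_eq_zero, qBinom_self, qBinom_zero_right]
  · simp [add_comm]
  · intro j hj
    rw [qBinom_root hn hζ (by omega) (by have := Finset.mem_range.1 hj; omega), zero_smul]

end qBinomial

section

variable {k : Type u} [Field k] {n : ℕ} {ζ : k} (hn : 1 < n) (hζ : IsPrimitiveRoot ζ n)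

noncomputable instance : Ring (TaftAlgebra hn hζ) := inferInstanceAs (Ring (RingQuot (Rel n ζ)))

noncomputable instance : Algebra k (TaftAlgebra hn hζ) :=
  inferInstanceAs (Algebra k (RingQuot (Rel n ζ)))

/-- The generator `K` of the Taft algebra. -/
noncomputable def K : TaftAlgebra hn hζ := RingQuot.mkAlgHom k (Rel n ζ) (FreeAlgebra.ι k Gen.K)

/-- The generator `X` of the Taft algebra. -/
noncomputable def X : TaftAlgebra hn hζ := RingQuot.mkAlgHom k (Rel n ζ) (FreeAlgebra.ι k Gen.X)

theorem K_mul_X : K hn hζ * X hn hζ = ζ • (X hn hζ * K hn hζ) := by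
  have := RingQuot.mkAlgHom_rel k (Rel.comm (n := n) (ζ := ζ))
  rw [map_mul, map_smul, map_mul] at this
  exact this

theorem K_pow : K hn hζ ^ n = 1 := by
  have := RingQuot.mkAlgHom_rel k (Rel.pow_K (n := n) (ζ := ζ))
  rw [map_pow, map_one] at this
  exact this

theorem X_pow : X hn hζ ^ n = 0 := by
  have := RingQuot.mkAlgHom_rel k (Rel.pow_X (n := n) (ζ := ζ))
  rw [map_pow, map_zero] at this
  exact this

/-- The algebra homomorphism from the Taft algebra given by the images `a`, `b` of `K`, `X`. -/
noncomputable def lift {A : Type*} [Ring A] [Algebra k A] (a b : A) (h1 : a * b = ζ • (b * a))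
    (h2 : a ^ n = 1) (h3 : b ^ n = 0) : TaftAlgebra hn hζ →ₐ[k] A :=
  RingQuot.liftAlgHom k ⟨FreeAlgebra.lift k (fun g => match g with | Gen.K => a | Gen.X => b), by
    rintro _ _ (_ | _ | _)
    · simpa using h1
    · simpa using h2
    · simpa using h3⟩

section

variable {A : Type*} [Ring A] [Algebra k A] (a b : A) (h1 : a * b = ζ • (b * a))
    (h2 : a ^ n = 1) (h3 : b ^ n = 0)

@[simp]
theorem lift_K : lift hn hζ a b h1 h2 h3 (K hn hζ) = a := by
  refine (RingQuot.liftAlgHom_mkAlgHom_apply _ _ _ _).trans ?_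
  simp

@[simp]
theorem lift_X : lift hn hζ a b h1 h2 h3 (X hn hζ) = b := by
  refine (RingQuot.liftAlgHom_mkAlgHom_apply _ _ _ _).trans ?_
  simp

end

theorem algHom_ext {hn : 1 < n} {hζ : IsPrimitiveRoot ζ n} {A : Type*} [Ring A] [Algebra k A]
    {f g : TaftAlgebra hn hζ →ₐ[k] A} (hK : f (K hn hζ) = g (K hn hζ))
    (hX : f (X hn hζ) = g (X hn hζ)) : f = g := by
  refine RingQuot.ringQuot_ext' (S := k) (s := Rel n ζ) f g ?_
  refine FreeAlgebra.hom_ext (funext fun x => ?_)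
  cases x
  · exact hK
  · exact hX

/-- The algebra is generated by `K` and `X`. -/
theorem mem_of_subalgebra (S : Subalgebra k (TaftAlgebra hn hζ)) (hK : K hn hζ ∈ S)
    (hX : X hn hζ ∈ S) (x : TaftAlgebra hn hζ) : x ∈ S := by
  let f : TaftAlgebra hn hζ →ₐ[k] S := lift hn hζ ⟨_, hK⟩ ⟨_, hX⟩
    (Subtype.ext (K_mul_X hn hζ)) (Subtype.ext (K_pow hn hζ)) (Subtype.ext (X_pow hn hζ))
  have : S.val.comp f = AlgHom.id k _ := algHom_ext (by simp [f]) (by simp [f])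
  rw [← AlgHom.id_apply (R := k) x, ← this]
  exact (f x).2

/-- The comultiplication `Δ(K) = K ⊗ K`, `Δ(X) = X ⊗ 1 + K ⊗ X`. -/
noncomputable def comulHom :
    TaftAlgebra hn hζ →ₐ[k] TaftAlgebra hn hζ ⊗[k] TaftAlgebra hn hζ :=
  lift hn hζ (K hn hζ ⊗ₜ K hn hζ) (X hn hζ ⊗ₜ 1 + K hn hζ ⊗ₜ X hn hζ)
    (by
      rw [mul_add, add_mul, smul_add]
      simp only [Algebra.TensorProduct.tmul_mul_tmul, mul_one, one_mul, K_mul_X,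
        TensorProduct.smul_tmul', TensorProduct.tmul_smul])
    (by simp only [Algebra.TensorProduct.tmul_pow, K_pow, Algebra.TensorProduct.one_def])
    (by
      rw [add_pow_root hn hζ]
      · simp only [Algebra.TensorProduct.tmul_pow, X_pow, TensorProduct.zero_tmul,
          TensorProduct.tmul_zero, add_zero]
      · simp only [Algebra.TensorProduct.tmul_mul_tmul, mul_one, one_mul, K_mul_X,
          TensorProduct.smul_tmul'])

/-- The counit `ε(K) = 1`, `ε(X) = 0`. -/
noncomputable def counitHom : TaftAlgebra hn hζ →ₐ[k] k :=
  lift hn hζ 1 0 (by simp) (by simp) (zero_pow (by omega))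

noncomputable instance : Bialgebra k (TaftAlgebra hn hζ) :=
  Bialgebra.ofAlgHom (comulHom hn hζ) (counitHom hn hζ)
    (algHom_ext (by simp [comulHom])
      (by simp [comulHom, TensorProduct.tmul_add, TensorProduct.add_tmul,
        Algebra.TensorProduct.one_def, add_assoc]))
    (algHom_ext (by simp [comulHom, counitHom]) (by simp [comulHom, counitHom]))
    (algHom_ext (by simp [comulHom, counitHom]) (by simp [comulHom, counitHom]))

theorem comul_K : comul (R := k) (K hn hζ) = K hn hζ ⊗ₜ K hn hζ := lift_K ..

theorem comul_X : comul (R := k) (X hn hζ) = X hn hζ ⊗ₜ 1 + K hn hζ ⊗ₜ X hn hζ := lift_X ..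

theorem counit_K : counit (R := k) (K hn hζ) = 1 := lift_K ..

theorem counit_X : counit (R := k) (X hn hζ) = 0 := lift_X ..

theorem K_mul_K_pow : K hn hζ * K hn hζ ^ (n - 1) = 1 := by
  rw [← pow_succ', Nat.sub_add_cancel hn.le, K_pow]

theorem K_pow_mul_K : K hn hζ ^ (n - 1) * K hn hζ = 1 := by
  rw [← pow_succ, Nat.sub_add_cancel hn.le, K_pow]

theorem K_pow_mul_X (m : ℕ) :
    K hn hζ ^ m * X hn hζ = ζ ^ m • (X hn hζ * K hn hζ ^ m) := by
  induction m with
  | zero => simp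
  | succ m ih =>
    rw [pow_succ, mul_assoc, K_mul_X, mul_smul_comm, ← mul_assoc, ih, smul_mul_assoc, smul_smul,
      mul_assoc, ← pow_succ, ← pow_succ']

theorem exists_mul_pow {A : Type*} [Ring A] [Algebra k A] (a b : A) (c : k)
    (h : b * a = c • (a * b)) (m : ℕ) : ∃ d : k, (a * b) ^ m = d • (a ^ m * b ^ m) := by
  have hb : ∀ j, b * a ^ j = c ^ j • (a ^ j * b) := by
    intro j
    induction j with
    | zero => simp
    | succ j ih =>
      rw [pow_succ, ← mul_assoc, ih, smul_mul_assoc, mul_assoc, h, mul_smul_comm, smul_smul,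
        ← pow_succ, mul_assoc]
  induction m with
  | zero => exact ⟨1, by simp⟩
  | succ m ih =>
    obtain ⟨d, hd⟩ := ih
    refine ⟨d * c ^ m, ?_⟩
    rw [pow_succ', hd, mul_smul_comm, mul_assoc, ← mul_assoc b, hb, smul_mul_assoc, mul_smul_comm,
      smul_smul, mul_assoc, ← pow_succ', ← mul_assoc, ← pow_succ']

theorem X_mul_K_pow : X hn hζ * K hn hζ ^ (n - 1) = ζ • (K hn hζ ^ (n - 1) * X hn hζ) := by
  rw [K_pow_mul_X, smul_smul, ← pow_succ', Nat.sub_add_cancel hn.le, hζ.pow_eq_one, one_smul]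

/-- The antipode `S(K) = K⁻¹`, `S(X) = -K⁻¹X`, as a homomorphism to the opposite algebra
(where `K⁻¹ = K^(n-1)`). -/
noncomputable def antipodeHom : TaftAlgebra hn hζ →ₐ[k] (TaftAlgebra hn hζ)ᵐᵒᵖ :=
  lift hn hζ (MulOpposite.op (K hn hζ ^ (n - 1))) (MulOpposite.op (-(K hn hζ ^ (n - 1) * X hn hζ)))
    (by
      rw [← MulOpposite.op_mul, ← MulOpposite.op_mul, ← MulOpposite.op_smul]
      congr 1
      rw [neg_mul, mul_neg, smul_neg, mul_assoc, X_mul_K_pow, mul_smul_comm])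
    (by rw [← MulOpposite.op_pow, ← pow_mul, mul_comm, pow_mul, K_pow, one_pow]; rfl)
    (by
      obtain ⟨d, hd⟩ := exists_mul_pow _ _ ζ (X_mul_K_pow hn hζ) n
      rw [← MulOpposite.op_pow, neg_pow, hd, X_pow, mul_zero, smul_zero, mul_zero]; rfl)

/-- The antipode as a linear map. -/
noncomputable def antipodeLin : TaftAlgebra hn hζ →ₗ[k] TaftAlgebra hn hζ :=
  (MulOpposite.opLinearEquiv k).symm.toLinearMap ∘ₗ (antipodeHom hn hζ).toLinearMap

theorem antipodeLin_one : antipodeLin hn hζ 1 = 1 := by simp [antipodeLin]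

theorem antipodeLin_mul (a b : TaftAlgebra hn hζ) :
    antipodeLin hn hζ (a * b) = antipodeLin hn hζ b * antipodeLin hn hζ a := by
  simp [antipodeLin]

theorem antipodeLin_K : antipodeLin hn hζ (K hn hζ) = K hn hζ ^ (n - 1) := by
  simp [antipodeLin, antipodeHom]

theorem antipodeLin_X : antipodeLin hn hζ (X hn hζ) = -(K hn hζ ^ (n - 1) * X hn hζ) := by
  simp [antipodeLin, antipodeHom]

theorem mul_rTensor (s : (TaftAlgebra hn hζ) ⊗[k] TaftAlgebra hn hζ) (a b : TaftAlgebra hn hζ) :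
    LinearMap.mul' k _ (LinearMap.rTensor _ (antipodeLin hn hζ) (s * a ⊗ₜ b)) =
      (antipodeLin hn hζ) a * LinearMap.mul' k _ (LinearMap.rTensor _ (antipodeLin hn hζ) s) * b := by
  induction s using TensorProduct.induction_on with
  | zero => simp
  | add x y hx hy => simp only [add_mul, mul_add, map_add, hx, hy]
  | tmul x y => simp [antipodeLin_mul, mul_assoc]

theorem mul_lTensor (t : (TaftAlgebra hn hζ) ⊗[k] TaftAlgebra hn hζ) (a b : TaftAlgebra hn hζ) :
    LinearMap.mul' k _ (LinearMap.lTensor _ (antipodeLin hn hζ) (a ⊗ₜ b * t)) =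
      a * LinearMap.mul' k _ (LinearMap.lTensor _ (antipodeLin hn hζ) t) * (antipodeLin hn hζ) b := by
  induction t using TensorProduct.induction_on with
  | zero => simp
  | add x y hx hy => simp only [add_mul, mul_add, map_add, hx, hy]
  | tmul x y => simp [antipodeLin_mul, mul_assoc]

/-- The elements at which the first antipode axiom holds. -/
noncomputable def leftSubalgebra : Subalgebra k (TaftAlgebra hn hζ) where
  carrier := {h | LinearMap.mul' k _ (LinearMap.rTensor _ (antipodeLin hn hζ) (comul (R := k) h)) =
    algebraMap k (TaftAlgebra hn hζ) (counit (R := k) h)}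
  mul_mem' {g h} hg hh := by
    have key : ∀ t : (TaftAlgebra hn hζ) ⊗[k] (TaftAlgebra hn hζ),
        LinearMap.mul' k _ (LinearMap.rTensor _ (antipodeLin hn hζ) (comul (R := k) g * t)) =
          counit (R := k) g • LinearMap.mul' k _ (LinearMap.rTensor _ (antipodeLin hn hζ) t) := by
      intro t
      induction t using TensorProduct.induction_on with
      | zero => simp
      | add x y hx hy => simp only [mul_add, map_add, hx, hy, smul_add]
      | tmul x y =>
        rw [mul_rTensor, hg, ← Algebra.commutes, ← Algebra.smul_def]
        simp
    change _ = _
    rw [Bialgebra.comul_mul, key, hh, Bialgebra.counit_mul, map_mul, Algebra.smul_def]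
  add_mem' {g h} hg hh := by
    change _ = _
    rw [map_add, map_add, map_add, hg, hh, map_add, map_add]
  algebraMap_mem' c := by
    change _ = _
    rw [Bialgebra.comul_algebraMap, Bialgebra.counit_algebraMap,
      Algebra.TensorProduct.algebraMap_apply]
    simp [Algebra.algebraMap_eq_smul_one, antipodeLin_one]

/-- The elements at which the second antipode axiom holds. -/
noncomputable def rightSubalgebra : Subalgebra k (TaftAlgebra hn hζ) where
  carrier := {h | LinearMap.mul' k _ (LinearMap.lTensor _ (antipodeLin hn hζ) (comul (R := k) h)) =
    algebraMap k (TaftAlgebra hn hζ) (counit (R := k) h)}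
  mul_mem' {g h} hg hh := by
    have key : ∀ t : (TaftAlgebra hn hζ) ⊗[k] (TaftAlgebra hn hζ),
        LinearMap.mul' k _ (LinearMap.lTensor _ (antipodeLin hn hζ) (t * comul (R := k) h)) =
          counit (R := k) h • LinearMap.mul' k _ (LinearMap.lTensor _ (antipodeLin hn hζ) t) := by
      intro t
      induction t using TensorProduct.induction_on with
      | zero => simp
      | add x y hx hy => simp only [add_mul, map_add, hx, hy, smul_add]
      | tmul x y =>
        rw [mul_lTensor, hh, ← Algebra.commutes, mul_assoc, ← Algebra.smul_def]
        simp
    change _ = _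
    rw [Bialgebra.comul_mul, key, hg, Bialgebra.counit_mul, map_mul, ← Algebra.commutes,
      Algebra.smul_def]
  add_mem' {g h} hg hh := by
    change _ = _
    rw [map_add, map_add, map_add, hg, hh, map_add, map_add]
  algebraMap_mem' c := by
    change _ = _
    rw [Bialgebra.comul_algebraMap, Bialgebra.counit_algebraMap,
      Algebra.TensorProduct.algebraMap_apply]
    simp [Algebra.algebraMap_eq_smul_one, antipodeLin_one]

/-- The Taft Hopf algebra. -/
noncomputable instance : HopfAlgebra k (TaftAlgebra hn hζ) where
  antipode := antipodeLin hn hζ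
  mul_antipode_rTensor_comul := LinearMap.ext <| mem_of_subalgebra hn hζ (leftSubalgebra hn hζ)
    (by
      change _ = _
      rw [comul_K, counit_K]
      simp [antipodeLin_K, K_pow_mul_K])
    (by
      change _ = _
      rw [comul_X, counit_X]
      simp [antipodeLin_K, antipodeLin_X])
  mul_antipode_lTensor_comul := LinearMap.ext <| mem_of_subalgebra hn hζ (rightSubalgebra hn hζ)
    (by
      change _ = _
      rw [comul_K, counit_K]
      simp [antipodeLin_K, K_mul_K_pow])
    (by
      change _ = _
      rw [comul_X, counit_X]
      simp [antipodeLin_X, antipodeLin_one, ← mul_assoc, K_mul_K_pow])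

/-- The span of the monomials `K^i X^j`. -/
noncomputable def monomialSpan : Submodule k (TaftAlgebra hn hζ) :=
  Submodule.span k (Set.range fun p : Fin n × Fin n => K hn hζ ^ (p.1 : ℕ) * X hn hζ ^ (p.2 : ℕ))

theorem monomial_mem (i j : ℕ) : K hn hζ ^ i * X hn hζ ^ j ∈ monomialSpan hn hζ := by
  have h0 : 0 < n := by omega
  by_cases hj : j < n
  · rw [← Nat.div_add_mod i n, pow_add, pow_mul, K_pow, one_pow, one_mul]
    exact Submodule.subset_span ⟨(⟨i % n, Nat.mod_lt _ h0⟩, ⟨j, hj⟩), rfl⟩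
  · rw [← Nat.add_sub_of_le (not_lt.1 hj), pow_add, X_pow, zero_mul, mul_zero]
    exact Submodule.zero_mem _

/-- The elements that multiply the span of the monomials into itself. -/
noncomputable def stabilizer : Subalgebra k (TaftAlgebra hn hζ) where
  carrier := {a | ∀ w ∈ monomialSpan hn hζ, a * w ∈ monomialSpan hn hζ}
  mul_mem' {a b} ha hb w hw := by rw [mul_assoc]; exact ha _ (hb _ hw)
  add_mem' {a b} ha hb w hw := by rw [add_mul]; exact Submodule.add_mem _ (ha _ hw) (hb _ hw)
  algebraMap_mem' c w hw := by rw [← Algebra.smul_def]; exact Submodule.smul_mem _ _ hw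

theorem mem_stabilizer {a : TaftAlgebra hn hζ}
    (h : ∀ i j, a * (K hn hζ ^ i * X hn hζ ^ j) ∈ monomialSpan hn hζ) : a ∈ stabilizer hn hζ := by
  intro w hw
  induction hw using Submodule.span_induction with
  | mem x hx => obtain ⟨p, rfl⟩ := hx; exact h _ _
  | zero => rw [mul_zero]; exact Submodule.zero_mem _
  | add x y _ _ hx hy => rw [mul_add]; exact Submodule.add_mem _ hx hy
  | smul c x _ hx => rw [mul_smul_comm]; exact Submodule.smul_mem _ _ hx

instance : Module.Finite k (TaftAlgebra hn hζ) := by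
  refine ⟨?_⟩
  have htop : monomialSpan hn hζ = ⊤ := by
    refine eq_top_iff.2 fun a _ => ?_
    have ha : a ∈ stabilizer hn hζ := mem_of_subalgebra hn hζ _
      (mem_stabilizer hn hζ fun i j => by
        rw [← mul_assoc, ← pow_succ']; exact monomial_mem hn hζ _ _)
      (mem_stabilizer hn hζ fun i j => by
        have h := K_pow_mul_X hn hζ i
        have h' : X hn hζ * K hn hζ ^ i = (ζ ^ i)⁻¹ • (K hn hζ ^ i * X hn hζ) := by
          rw [h, smul_smul, inv_mul_cancel₀ (pow_ne_zero _ (hζ.ne_zero (by omega))), one_smul]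
        rw [← mul_assoc, h', smul_mul_assoc, mul_assoc, ← pow_succ']
        exact Submodule.smul_mem _ _ (monomial_mem hn hζ _ _)) a
    simpa using ha 1 (by simpa using monomial_mem hn hζ 0 0)
  rw [← htop]
  exact Submodule.fg_span (Set.finite_range _)

/-- The operator `K` on sequences used to see that the integral is nonzero. -/
noncomputable def opK (ζ : k) : Module.End k (ℕ → k) :=
  LinearMap.pi fun i => ζ ^ (i + 1) • LinearMap.proj i

/-- The operator `X` on sequences: the shift, truncated at `n`. -/
noncomputable def opX (k : Type u) [Field k] (n : ℕ) : Module.End k (ℕ → k) :=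
  LinearMap.pi fun i => if 0 < i ∧ i < n then LinearMap.proj (i - 1) else 0

theorem opK_pow (ζ : k) (m : ℕ) (f : ℕ → k) (i : ℕ) :
    (opK ζ ^ m) f i = ζ ^ ((i + 1) * m) * f i := by
  induction m generalizing f with
  | zero => simp
  | succ m ih =>
    rw [pow_succ, Module.End.mul_apply, ih]
    simp [opK]; ring

theorem opX_pow (n m : ℕ) (f : ℕ → k) (i : ℕ) (hi : i < n) :
    (opX k n ^ m) f i = if m ≤ i then f (i - m) else 0 := by
  induction m generalizing f with
  | zero => simp
  | succ m ih =>
    rw [pow_succ, Module.End.mul_apply, ih]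
    by_cases h : m ≤ i
    · by_cases h' : m + 1 ≤ i
      · have h2 : 0 < i - m ∧ i - m < n := by omega
        rw [if_pos h, if_pos h']
        simp only [opX, LinearMap.pi_apply, if_pos h2, LinearMap.proj_apply]
        congr 1
      · have h2 : ¬ (0 < i - m ∧ i - m < n) := by omega
        rw [if_pos h, if_neg h']
        simp only [opX, LinearMap.pi_apply, if_neg h2, LinearMap.zero_apply]
    · rw [if_neg h, if_neg (by omega)]

/-- An action of the Taft algebra on sequences. -/
noncomputable def seqRep : TaftAlgebra hn hζ →ₐ[k] Module.End k (ℕ → k) :=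
  lift hn hζ (opK ζ) (opX k n)
    (by
      ext f i
      by_cases h : 0 < i ∧ i < n
      · obtain ⟨i, rfl⟩ : ∃ j, i = j + 1 := ⟨i - 1, by omega⟩
        simp [opK, opX, h.2]; ring
      · simp [opK, opX, h])
    (by
      ext f i
      rw [opK_pow, mul_comm (i + 1), pow_mul, hζ.pow_eq_one, one_pow, one_mul]; rfl)
    (by
      refine LinearMap.ext fun f => funext fun i => ?_
      by_cases hi : i < n
      · rw [opX_pow n n f i hi, if_neg (by omega)]; rfl
      · obtain ⟨m, rfl⟩ : ∃ m, n = m + 1 := ⟨n - 1, by omega⟩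
        rw [pow_succ', Module.End.mul_apply]
        have h2 : ¬ (0 < i ∧ i < m + 1) := fun h => hi h.2
        exact LinearMap.congr_fun (if_neg h2) _)

/-- The left integral `(1 + K + ⋯ + K^(n-1)) X^(n-1)` of the Taft algebra. -/
noncomputable def integral : LeftIntegral k (TaftAlgebra hn hζ) where
  elem := (∑ i ∈ Finset.range n, K hn hζ ^ i) * X hn hζ ^ (n - 1)
  ne_zero h0 := by
    have h1 := congrArg (fun a => seqRep hn hζ a (Pi.single 0 1) (n - 1)) h0
    have hlt : n - 1 < n := by omega
    have : NeZero n := ⟨by omega⟩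
    have := hζ.neZero'
    have e : ∀ i, ((opK ζ ^ i) ((opX k n ^ (n - 1)) (Pi.single 0 1))) (n - 1) = 1 := by
      intro i
      rw [opK_pow, opX_pow _ _ _ _ hlt, if_pos le_rfl, Nat.sub_add_cancel hn.le, pow_mul,
        hζ.pow_eq_one]
      simp
    simp [seqRep, Module.End.mul_apply, LinearMap.sum_apply, e] at h1
    exact NeZero.ne (n : k) h1
  mul_elem h := by
    refine mem_of_subalgebra hn hζ
      { carrier := {a | a * ((∑ i ∈ Finset.range n, K hn hζ ^ i) * X hn hζ ^ (n - 1)) =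
          counit (R := k) a • ((∑ i ∈ Finset.range n, K hn hζ ^ i) * X hn hζ ^ (n - 1))}
        mul_mem' := fun {a b} ha hb => ?_
        add_mem' := fun {a b} ha hb => ?_
        algebraMap_mem' := fun c => ?_ } ?_ ?_ h
    · change _ = _
      rw [mul_assoc, hb, mul_smul_comm, ha, smul_smul, Bialgebra.counit_mul, mul_comm]
    · change _ = _
      rw [add_mul, ha, hb, map_add, add_smul]
    · change _ = _
      rw [Bialgebra.counit_algebraMap, Algebra.smul_def]
    · change _ = _
      rw [counit_K, one_smul, ← mul_assoc]
      congr 1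
      have h1 := Finset.sum_range_succ (fun i => K hn hζ ^ i) n
      rw [Finset.sum_range_succ', K_pow, pow_zero] at h1
      rw [Finset.mul_sum, ← add_right_cancel h1]
      exact Finset.sum_congr rfl fun i _ => (pow_succ' _ _).symm
    · change _ = _
      rw [counit_X, zero_smul, ← mul_assoc, Finset.mul_sum, Finset.sum_mul]
      refine Finset.sum_eq_zero fun i _ => ?_
      have h' : X hn hζ * K hn hζ ^ i = (ζ ^ i)⁻¹ • (K hn hζ ^ i * X hn hζ) := by
        rw [K_pow_mul_X, smul_smul, inv_mul_cancel₀ (pow_ne_zero _ (hζ.ne_zero (by omega))),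
          one_smul]
      rw [h', smul_mul_assoc, mul_assoc, ← pow_succ', Nat.sub_add_cancel hn.le, X_pow, mul_zero,
        smul_zero]

end

end Taft

/-! Split a module M into eigenspaces of K, let m_i be the multiplicity of ζ^i, and attach to M the
character ∑ m_i q^i. Modulo 1 + q + ⋯ + q^(n-1) the character depends only on the differences m_i -
m_(i+1), and these are stable invariants (`mult_add_mult_of_iso`). Indeed, by rank-nullity, m_i -
m_(i+1) is the dimension of the weight-i part of ker X / im X^(n-1) minus that of the weight-(i+1)
part of ker X^(n-1) / im X. Both homologies vanish on projectives, because H is a sum of strings w,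
Xw, …, X^(n-1)w; so a homomorphism that factors through a projective acts on them as zero.

Since K is group-like, the character is multiplicative for ⊗ (`character_tensor`). It vanishes on H,
hence on H ⊗ M, and the exact sequence 0 → M → N ⊕ (H ⊗ M) → C_u → 0 makes it additive on
distinguished triangles. This gives `characterHom` on the Grothendieck group.

For bijectivity, let S_i be the one-dimensional module of weight i. Every nonzero module M contains
some S_i; the embedding S_i → H ⊗ S_i extends to M, so the cone of S_i → M is stably the cokernel M
/ S_i. By induction on dimension [M] = ∑ m_i [S_i] (`cls_eq_sum`). A projective string has each S_i
once as a composition factor, so ∑ [S_i] = 0. Hence q^i ↦ [S_i] is a surjection from ℤ[q] that kills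
the ideal, and its composite with the character is the quotient map (`characterHom_polyHom`).

The ring structure is carried back along this bijection, and [M][N] = [M ⊗ N] is read off from
multiplicativity of the character; no separate argument that ⊗ descends to the stable category is
needed. Uniqueness holds because multiplication is biadditive and the classes generate. -/

set_option linter.unusedSectionVars false

namespace Taft

/-! ### The weight idempotents of k[K] and Fourier analysis on ℤ/n -/

section Weights

variable {k : Type u} [Field k] [CharZero k] {n : ℕ} [NeZero n] {ζ : k} (hn : 1 < n)
  (hζ : IsPrimitiveRoot ζ n)

/-- The character `i ↦ ζ ^ i` of `ℤ/n`. -/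
noncomputable def chi {n : ℕ} [NeZero n] {ζ : k} (hζ : IsPrimitiveRoot ζ n) :
    AddChar (ZMod n) k :=
  AddChar.zmodChar n hζ.pow_eq_one

theorem chi_apply (i : ZMod n) : chi hζ i = ζ ^ i.val := AddChar.zmodChar_apply _ _

theorem chi_one : chi hζ 1 = ζ := by
  have h := AddChar.zmodChar_apply' hζ.pow_eq_one 1
  rwa [Nat.cast_one, pow_one] at h

theorem chi_mul_neg (i : ZMod n) : chi hζ i * chi hζ (-i) = 1 := by
  rw [← AddChar.map_add_eq_mul, add_neg_cancel, AddChar.map_zero_eq_one]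

/-- Orthogonality of characters of ℤ/n, valid because ζ is primitive; all identities for the
idempotents reduce to it. -/
theorem sum_chi_mul (b : ZMod n) : ∑ a : ZMod n, chi hζ (a * b) = if b = 0 then (n : k) else 0 := by
  have h := AddChar.sum_mulShift b (AddChar.zmodChar_primitive_of_primitive_root n hζ)
  rw [ZMod.card] at h
  push_cast at h
  exact h

/-- The powers of `K`, with exponents in `ℤ/n`. -/
noncomputable def Kpow (j : ZMod n) : TaftAlgebra hn hζ := K hn hζ ^ j.val

theorem Kpow_natCast (j : ℕ) : Kpow hn hζ (j : ZMod n) = K hn hζ ^ j := by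
  rw [Kpow, ZMod.val_natCast, ← pow_eq_pow_mod j (K_pow hn hζ)]

theorem Kpow_add (i j : ZMod n) : Kpow hn hζ (i + j) = Kpow hn hζ i * Kpow hn hζ j := by
  obtain ⟨i, rfl⟩ := ZMod.natCast_zmod_surjective i
  obtain ⟨j, rfl⟩ := ZMod.natCast_zmod_surjective j
  rw [← Nat.cast_add, Kpow_natCast, Kpow_natCast, Kpow_natCast, pow_add]

theorem Kpow_zero : Kpow hn hζ 0 = 1 := by
  simpa using Kpow_natCast hn hζ 0

theorem Kpow_one : Kpow hn hζ 1 = K hn hζ := by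
  simpa using Kpow_natCast hn hζ 1

theorem chi_pow_val (i j : ZMod n) : chi hζ i ^ j.val = chi hζ (i * j) := by
  rw [← AddChar.map_nsmul_eq_pow, nsmul_eq_mul, ZMod.natCast_zmod_val, mul_comm]

theorem comul_Kpow (j : ZMod n) :
    comul (R := k) (Kpow hn hζ j) = Kpow hn hζ j ⊗ₜ Kpow hn hζ j := by
  have := map_pow (Bialgebra.comulAlgHom k (TaftAlgebra hn hζ)) (K hn hζ) j.val
  simp only [Bialgebra.comulAlgHom_apply, comul_K, Algebra.TensorProduct.tmul_pow] at this
  exact this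

/-- The idempotent of `k[K]` that projects onto the eigenspace of `K` for `ζ ^ i`. -/
noncomputable def weightIdem (i : ZMod n) : TaftAlgebra hn hζ :=
  (n : k)⁻¹ • ∑ j : ZMod n, chi hζ (-(i * j)) • Kpow hn hζ j

theorem K_mul_weightIdem (i : ZMod n) :
    K hn hζ * weightIdem hn hζ i = chi hζ i • weightIdem hn hζ i := by
  rw [weightIdem, mul_smul_comm, smul_comm]
  congr 1
  rw [Finset.mul_sum, Finset.smul_sum]
  -- Multiplication by K shifts the summation index j by one, at the cost of the factor ζ^i.
  refine Fintype.sum_equiv (Equiv.addLeft 1) _ _ fun j => ?_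
  rw [mul_smul_comm, Equiv.coe_addLeft, Kpow_add, Kpow_one, smul_smul, ← AddChar.map_add_eq_mul]
  congr 2
  ring

/-- Summing over i first, orthogonality leaves only the term K^0, with coefficient n, which cancels
1/n. -/
theorem sum_weightIdem : ∑ i, weightIdem hn hζ i = 1 := by
  simp only [weightIdem]
  rw [← Finset.smul_sum, Finset.sum_comm]
  have : ∀ j : ZMod n, ∑ i : ZMod n, chi hζ (-(i * j)) • Kpow hn hζ j =
      if j = 0 then (n : k) • (1 : TaftAlgebra hn hζ) else 0 := by
    intro j
    rw [← Finset.sum_smul]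
    simp only [← mul_neg, sum_chi_mul, neg_eq_zero]
    split_ifs with h
    · rw [h, Kpow_zero]
    · rw [zero_smul]
  simp only [this, Finset.sum_ite_eq', Finset.mem_univ, if_true]
  rw [smul_smul, inv_mul_cancel₀ (NeZero.ne _), one_smul]

theorem K_pow_mul_weightIdem (i : ZMod n) (j : ℕ) :
    K hn hζ ^ j * weightIdem hn hζ i = chi hζ i ^ j • weightIdem hn hζ i := by
  induction j with
  | zero => simp
  | succ j ih => rw [pow_succ', mul_assoc, ih, mul_smul_comm, K_mul_weightIdem, smul_smul, pow_succ]

/-- On an eigenvector of `K` the idempotents act by `0` or `1`. -/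
theorem rho_weightIdem_of_eigenvector (M : FDMod k (TaftAlgebra hn hζ)) (i j : ZMod n)
    {x : M.carrier} (hx : M.ρ (K hn hζ) x = chi hζ j • x) :
    M.ρ (weightIdem hn hζ i) x = if i = j then x else 0 := by
  have h : ∀ a : ℕ, M.ρ (K hn hζ ^ a) x = chi hζ j ^ a • x := by
    intro a
    induction a with
    | zero => simp
    | succ a ih =>
      rw [pow_succ', map_mul, Module.End.mul_apply, ih, map_smul, hx, smul_smul, pow_succ]
  simp only [weightIdem, map_smul, map_sum, LinearMap.smul_apply, LinearMap.sum_apply, Kpow, h,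
    smul_smul, chi_pow_val hζ]
  rw [← Finset.sum_smul]
  have : ∀ a : ZMod n, chi hζ (-(i * a)) * chi hζ (j * a) = chi hζ (a * (j - i)) := by
    intro a
    rw [← AddChar.map_add_eq_mul]
    congr 1
    ring
  simp only [this, sum_chi_mul, smul_smul, sub_eq_zero]
  by_cases hij : i = j
  · rw [if_pos hij.symm, if_pos hij, inv_mul_cancel₀ (NeZero.ne _), one_smul]
  · rw [if_neg (Ne.symm hij), if_neg hij, mul_zero, zero_smul]

theorem rho_K_rho_weightIdem (M : FDMod k (TaftAlgebra hn hζ)) (i : ZMod n) (x : M.carrier) :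
    M.ρ (K hn hζ) (M.ρ (weightIdem hn hζ i) x) = chi hζ i • M.ρ (weightIdem hn hζ i) x := by
  rw [← Module.End.mul_apply, ← map_mul, K_mul_weightIdem, map_smul, LinearMap.smul_apply]

/-- In the regular module `weightIdem j` is itself an eigenvector of K, so the preceding description
of the action on eigenvectors applies. -/
theorem weightIdem_mul (i j : ZMod n) :
    weightIdem hn hζ i * weightIdem hn hζ j = if i = j then weightIdem hn hζ j else 0 :=
  rho_weightIdem_of_eigenvector hn hζ (FDMod.reg k (TaftAlgebra hn hζ)) i j
    (x := weightIdem hn hζ j) (K_mul_weightIdem hn hζ j)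

/-- X raises weights by one, since KX = ζXK: moving X past K^j multiplies the j-th Fourier
coefficient by ζ^j. -/
theorem X_mul_weightIdem (i : ZMod n) :
    X hn hζ * weightIdem hn hζ i = weightIdem hn hζ (i + 1) * X hn hζ := by
  have h : ∀ j : ZMod n, X hn hζ * Kpow hn hζ j = chi hζ (-j) • (Kpow hn hζ j * X hn hζ) := by
    intro j
    rw [Kpow, K_pow_mul_X, smul_smul, ← chi_apply hζ, mul_comm, chi_mul_neg hζ, one_smul]
  rw [weightIdem, weightIdem, mul_smul_comm, smul_mul_assoc, Finset.mul_sum, Finset.sum_mul]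
  congr 1
  refine Finset.sum_congr rfl fun j _ => ?_
  rw [mul_smul_comm, h, smul_smul, smul_mul_assoc, ← AddChar.map_add_eq_mul]
  congr 2
  ring

theorem X_pow_mul_weightIdem (i : ZMod n) (m : ℕ) :
    X hn hζ ^ m * weightIdem hn hζ i = weightIdem hn hζ (i + m) * X hn hζ ^ m := by
  induction m with
  | zero => simp
  | succ m ih =>
    rw [pow_succ', mul_assoc, ih, ← mul_assoc, X_mul_weightIdem, mul_assoc, ← pow_succ']
    push_cast
    rw [add_assoc]

/-- X^(n-1) raises weights by n - 1, which is -1 in ℤ/n. -/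
theorem X_pow_pred_mul_weightIdem (i : ZMod n) :
    X hn hζ ^ (n - 1) * weightIdem hn hζ (i + 1) = weightIdem hn hζ i * X hn hζ ^ (n - 1) := by
  rw [X_pow_mul_weightIdem, Nat.cast_sub hn.le]
  simp

/-- Fourier inversion: multiply by 1 = ∑ e_a and let K^j act on each e_a by its eigenvalue. -/
theorem Kpow_eq_sum (j : ZMod n) :
    Kpow hn hζ j = ∑ a, chi hζ (a * j) • weightIdem hn hζ a := by
  rw [← mul_one (Kpow hn hζ j), ← sum_weightIdem, Finset.mul_sum]
  exact Finset.sum_congr rfl fun a _ => by rw [Kpow, K_pow_mul_weightIdem, chi_pow_val hζ]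

/-- The powers of K are group-like, so expanding K^j ⊗ K^j by Fourier inversion and using
orthogonality leaves the pairs of weights with sum i. This is the source of the multiplicativity of
the character. -/
theorem comul_weightIdem (i : ZMod n) :
    comul (R := k) (weightIdem hn hζ i) =
      ∑ a, ∑ b, if a + b = i then weightIdem hn hζ a ⊗ₜ[k] weightIdem hn hζ b else 0 := by
  have h : ∀ a b j : ZMod n, chi hζ (-(i * j)) * (chi hζ (b * j) * chi hζ (a * j)) =
      chi hζ (j * (a + b - i)) := by
    intro a b j
    rw [← AddChar.map_add_eq_mul, ← AddChar.map_add_eq_mul]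
    congr 1
    ring
  rw [weightIdem, map_smul, map_sum]
  simp only [map_smul, comul_Kpow]
  simp only [Kpow_eq_sum, TensorProduct.sum_tmul, TensorProduct.tmul_sum,
    ← TensorProduct.smul_tmul', TensorProduct.tmul_smul, smul_smul, Finset.smul_sum, h]
  rw [Finset.sum_comm]
  conv_rhs => rw [Finset.sum_comm]
  refine Finset.sum_congr rfl fun b _ => ?_
  rw [Finset.sum_comm]
  refine Finset.sum_congr rfl fun a _ => ?_
  rw [← Finset.sum_smul, ← Finset.mul_sum, sum_chi_mul]
  simp only [sub_eq_zero]
  split_ifs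
  · rw [inv_mul_cancel₀ (NeZero.ne _), one_smul]
  · rw [mul_zero, zero_smul]

end Weights

end Taft

/-! ### Ranks of idempotents and their additivity -/

namespace FDMod

variable {k H : Type u} [Field k]

section Algebra

variable [Ring H] [Algebra k H]

theorem rho_mul_apply (M : FDMod k H) (a b : H) (x : M.carrier) :
    M.ρ (a * b) x = M.ρ a (M.ρ b x) := by
  rw [map_mul, Module.End.mul_apply]

/-- For an idempotent `e`, the dimension of `eM`. -/
noncomputable def idemRank (M : FDMod k H) (e : H) : ℕ :=
  Module.finrank k (LinearMap.range (M.ρ e))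

theorem mem_range_rho_iff (M : FDMod k H) {e : H} (he : e * e = e) (x : M.carrier) :
    x ∈ LinearMap.range (M.ρ e) ↔ M.ρ e x = x := by
  constructor
  · rintro ⟨y, rfl⟩
    rw [← rho_mul_apply, he]
  · exact fun h => ⟨x, h⟩

/-- The trace of a projection is its rank. In characteristic 0 the trace then determines the rank,
so identities between multiplicities can be checked on traces. -/
theorem cast_idemRank (M : FDMod k H) {e : H} (he : e * e = e) :
    (M.idemRank e : k) = LinearMap.trace k M.carrier (M.ρ e) := by
  refine (LinearMap.IsProj.trace (p := LinearMap.range (M.ρ e)) ⟨fun x => ⟨x, rfl⟩, ?_⟩).symm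
  exact fun x hx => (mem_range_rho_iff M he x).1 hx

/-- Cutting by an idempotent is exact: rank-nullity for eY → Y / X, whose image is e(Y / X) and
whose kernel is the image of eX. -/
theorem idemRank_coker {X Y : FDMod k H} (f : X ⟶ Y) (hf : Function.Injective (Hom.toLin f))
    {e : H} (he : e * e = e) : (coker f).idemRank e + X.idemRank e = Y.idemRank e := by
  let g := Hom.toLin (cokerMk f)
  let g' := g.domRestrict (LinearMap.range (Y.ρ e))
  have h1 : LinearMap.range g' = LinearMap.range ((coker f).ρ e) := by
    ext z
    constructor
    · rintro ⟨⟨_, y, rfl⟩, rfl⟩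
      exact ⟨g y, ((cokerMk f).comm e y).symm⟩
    · rintro ⟨w, rfl⟩
      obtain ⟨y, rfl⟩ := Submodule.mkQ_surjective _ w
      exact ⟨⟨_, y, rfl⟩, (cokerMk f).comm e y⟩
  have h2 : (LinearMap.ker g').map (LinearMap.range (Y.ρ e)).subtype =
      (LinearMap.range (X.ρ e)).map (Hom.toLin f) := by
    ext z
    constructor
    · rintro ⟨⟨z, hz⟩, h0, rfl⟩
      obtain ⟨x, hx⟩ : z ∈ LinearMap.range (Hom.toLin f) :=
        (Submodule.Quotient.mk_eq_zero _).1 h0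
      -- If z = f(x) lies in eY, then z = ez = f(ex), so x may be replaced by ex.
      refine ⟨X.ρ e x, ⟨x, rfl⟩, ?_⟩
      rw [Hom.comm, hx]
      exact (mem_range_rho_iff Y he z).1 hz
    · rintro ⟨_, ⟨x, rfl⟩, rfl⟩
      refine ⟨⟨Hom.toLin f (X.ρ e x), ?_⟩, ?_, rfl⟩
      · rw [Hom.comm]; exact ⟨_, rfl⟩
      · exact (Submodule.Quotient.mk_eq_zero _).2 ⟨_, rfl⟩
  have h3 := LinearMap.finrank_range_add_finrank_ker g'
  rw [h1, ← Submodule.finrank_map_subtype_eq, h2,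
    ← (Submodule.equivMapOfInjective _ hf _).finrank_eq] at h3
  exact h3

theorem trace_prod (X Y : FDMod k H) (a : H) :
    LinearMap.trace k (prod X Y).carrier ((prod X Y).ρ a) =
      LinearMap.trace k X.carrier (X.ρ a) + LinearMap.trace k Y.carrier (Y.ρ a) :=
  LinearMap.trace_prodMap' _ _

theorem idemRank_prod [CharZero k] (X Y : FDMod k H) {e : H} (he : e * e = e) :
    (prod X Y).idemRank e = X.idemRank e + Y.idemRank e := by
  apply Nat.cast_injective (R := k)
  rw [Nat.cast_add, cast_idemRank _ he, cast_idemRank _ he, cast_idemRank _ he, trace_prod]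

end Algebra

end FDMod

namespace Taft

open FDMod

/-! ### Multiplicities of weights and the character -/

section Character

variable {k : Type u} [Field k] [CharZero k] {n : ℕ} [NeZero n] {ζ : k} {hn : 1 < n}
  {hζ : IsPrimitiveRoot ζ n}

theorem weightIdem_idem (i : ZMod n) :
    weightIdem hn hζ i * weightIdem hn hζ i = weightIdem hn hζ i := by
  rw [weightIdem_mul, if_pos rfl]

/-- The multiplicity of `ζ ^ i` as an eigenvalue of `K`. -/
noncomputable def mult (M : FDMod k (TaftAlgebra hn hζ)) (i : ZMod n) : ℕ :=
  M.idemRank (weightIdem hn hζ i)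

theorem cast_mult (M : FDMod k (TaftAlgebra hn hζ)) (i : ZMod n) :
    (mult M i : k) = LinearMap.trace k M.carrier (M.ρ (weightIdem hn hζ i)) :=
  cast_idemRank M (weightIdem_idem i)

theorem sum_mult (M : FDMod k (TaftAlgebra hn hζ)) :
    ∑ i, mult M i = Module.finrank k M.carrier := by
  apply Nat.cast_injective (R := k)
  rw [Nat.cast_sum, ← LinearMap.trace_one, ← map_one M.ρ, ← sum_weightIdem hn hζ, map_sum, map_sum]
  exact Finset.sum_congr rfl fun i _ => cast_mult M i

/-- Take the trace of Δ(e_i) = ∑ e_a ⊗ e_b, over a + b = i, on M ⊗ N; the trace of a tensor product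
of maps is the product of the traces. -/
theorem mult_tensor (M N : FDMod k (TaftAlgebra hn hζ)) (i : ZMod n) :
    mult (tensor M N) i = ∑ a, ∑ b, if a + b = i then mult M a * mult N b else 0 := by
  apply Nat.cast_injective (R := k)
  have h : (tensor M N).ρ (weightIdem hn hζ i) =
      tensorAct M N (comul (R := k) (weightIdem hn hζ i)) := rfl
  rw [cast_mult, h, comul_weightIdem]
  change LinearMap.trace k (M.carrier ⊗[k] N.carrier) _ = _
  push_cast
  rw [map_sum, map_sum]
  refine Finset.sum_congr rfl fun a _ => ?_
  rw [map_sum, map_sum]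
  refine Finset.sum_congr rfl fun b _ => ?_
  split_ifs
  · rw [cast_mult, cast_mult]
    exact LinearMap.trace_tensorProduct' (M.ρ (weightIdem hn hζ a)) (N.ρ (weightIdem hn hζ b))
  · rw [map_zero, map_zero]

/-- The ring `ℤ[q] / (1 + q + ⋯ + q^(n-1))`. -/
abbrev CyclicRing (n : ℕ) : Type :=
  Polynomial ℤ ⧸ Ideal.span {∑ i ∈ Finset.range n, (Polynomial.X : Polynomial ℤ) ^ i}

/-- The class of `q`. -/
noncomputable def qClass (n : ℕ) : CyclicRing n := Ideal.Quotient.mk _ Polynomial.X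

theorem sum_qClass_pow (n : ℕ) : ∑ i ∈ Finset.range n, qClass n ^ i = 0 := by
  have := Ideal.Quotient.eq_zero_iff_mem.2
    (Ideal.mem_span_singleton_self (∑ i ∈ Finset.range n, (Polynomial.X : Polynomial ℤ) ^ i))
  simp only [map_sum, map_pow] at this
  exact this

theorem qClass_pow (n : ℕ) : qClass n ^ n = 1 := by
  have := geom_sum_mul (qClass n) n
  rw [sum_qClass_pow, zero_mul] at this
  exact (sub_eq_zero.1 this.symm)

/-- The powers of `q`, with exponents in `ℤ/n`. -/
noncomputable def qChar (n : ℕ) [NeZero n] : AddChar (ZMod n) (CyclicRing n) :=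
  AddChar.zmodChar n (qClass_pow n)

theorem qChar_natCast (i : ℕ) : qChar n i = qClass n ^ i := AddChar.zmodChar_apply' _ i

theorem sum_zmod_eq_sum_range {A : Type*} [AddCommMonoid A] (f : ZMod n → A) :
    ∑ i, f i = ∑ i ∈ Finset.range n, f i := by
  refine Finset.sum_bij' (fun i _ => i.val) (fun i _ => (i : ZMod n)) ?_ ?_ ?_ ?_ ?_
  · exact fun i _ => Finset.mem_range.2 (ZMod.val_lt i)
  · exact fun i _ => Finset.mem_univ _
  · exact fun i _ => ZMod.natCast_zmod_val i
  · exact fun i hi => ZMod.val_cast_of_lt (Finset.mem_range.1 hi)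
  · exact fun i _ => by rw [ZMod.natCast_zmod_val]

theorem sum_qChar : ∑ i, qChar n i = 0 := by
  rw [sum_zmod_eq_sum_range]
  simp only [qChar_natCast, sum_qClass_pow]

/-- The character `∑ i, m_i q^i` of a module, where `m_i` is the multiplicity of `ζ ^ i`. -/
noncomputable def character (M : FDMod k (TaftAlgebra hn hζ)) : CyclicRing n :=
  ∑ i, (mult M i : CyclicRing n) * qChar n i

theorem character_tensor (M N : FDMod k (TaftAlgebra hn hζ)) :
    character (tensor M N) = character M * character N := by
  rw [character, character, character, Finset.sum_mul_sum]
  simp only [mult_tensor, Nat.cast_sum, Finset.sum_mul]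
  rw [Finset.sum_comm]
  refine Finset.sum_congr rfl fun a _ => ?_
  rw [Finset.sum_comm]
  refine Finset.sum_congr rfl fun b _ => ?_
  rw [Finset.sum_eq_single (a + b)]
  · rw [if_pos rfl, Nat.cast_mul, AddChar.map_add_eq_mul]
    ring
  · intro i _ hi
    rw [if_neg (Ne.symm hi), Nat.cast_zero, zero_mul]
  · exact fun h => absurd (Finset.mem_univ _) h

theorem character_coker {M N : FDMod k (TaftAlgebra hn hζ)} (f : M ⟶ N)
    (hf : Function.Injective (Hom.toLin f)) :
    character (coker f) + character M = character N := by
  simp only [character]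
  rw [← Finset.sum_add_distrib]
  refine Finset.sum_congr rfl fun i _ => ?_
  rw [← add_mul, ← Nat.cast_add]
  congr 2
  exact idemRank_coker f hf (weightIdem_idem i)

theorem character_prod (M N : FDMod k (TaftAlgebra hn hζ)) :
    character (FDMod.prod M N) = character M + character N := by
  simp only [character]
  rw [← Finset.sum_add_distrib]
  refine Finset.sum_congr rfl fun i _ => ?_
  rw [← add_mul, ← Nat.cast_add]
  congr 2
  exact idemRank_prod M N (weightIdem_idem i)

/-- Modules whose multiplicities have the same consecutive differences have the same character. -/
theorem character_eq_of_mult {M N : FDMod k (TaftAlgebra hn hζ)}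
    (h : ∀ i, mult M i + mult N (i + 1) = mult N i + mult M (i + 1)) :
    character M = character N := by
  -- The multiplicities of M and N differ by a constant independent of i, so the characters differ
  -- by a multiple of ∑ q^i = 0.
  have hc : ∀ i : ℕ, (mult M (i : ZMod n) : ℤ) - mult N (i : ZMod n) = mult M 0 - mult N 0 := by
    intro i
    induction i with
    | zero => simp
    | succ i ih =>
      have := h i
      push_cast
      omega
  have hc' : ∀ i : ZMod n, (mult M i : CyclicRing n) - mult N i =
      ((mult M 0 - mult N 0 : ℤ) : CyclicRing n) := by
    intro i
    have := hc i.val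
    rw [ZMod.natCast_zmod_val] at this
    rw [← this]
    push_cast
    rfl
  rw [← sub_eq_zero, character, character, ← Finset.sum_sub_distrib]
  simp only [← sub_mul, hc']
  rw [← Finset.mul_sum, sum_qChar, mul_zero]

end Character

end Taft

namespace FDMod

variable {k H : Type u} [Field k]

/-! ### Comparison of homology dimensions; exactness on projectives -/

section Algebra

variable [Ring H] [Algebra k H]

/-- When A' ⊆ A, this says that f induces an injection A/A' → B/B': if f(x) ∈ B', then g(f(x)) ∈ A',
hence x ∈ A'. Quotients are avoided by the map A × B' → A' × B, (x, y) ↦ (g(f(x)) - x + g(y), f(x) +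
y), which is injective because f(x) + y = 0 turns the first component into -x. -/
theorem finrank_add_le {V W : Type*} [AddCommGroup V] [Module k V] [AddCommGroup W] [Module k W]
    [Module.Finite k V] [Module.Finite k W] (A A' : Submodule k V) (B B' : Submodule k W)
    (hB : B' ≤ B) (f : V →ₗ[k] W) (g : W →ₗ[k] V) (hf : ∀ x ∈ A, f x ∈ B)
    (hg : ∀ y ∈ B', g y ∈ A') (hgf : ∀ x ∈ A, g (f x) - x ∈ A') :
    Module.finrank k A + Module.finrank k B' ≤ Module.finrank k B + Module.finrank k A' := by
  rw [add_comm (Module.finrank k B), ← Module.finrank_prod, ← Module.finrank_prod]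
  let φ : A × B' →ₗ[k] A' × B :=
    { toFun := fun p => (⟨g (f p.1) - p.1 + g p.2, A'.add_mem (hgf _ p.1.2) (hg _ p.2.2)⟩,
        ⟨f p.1 + p.2, B.add_mem (hf _ p.1.2) (hB p.2.2)⟩)
      map_add' := fun p q => by
        ext
        · simp only [Prod.fst_add, Prod.snd_add, Submodule.coe_add, map_add]; abel
        · simp only [Prod.fst_add, Prod.snd_add, Submodule.coe_add, map_add]; abel
      map_smul' := fun c p => by
        ext
        · simp [smul_add, smul_sub]
        · simp [smul_add] }
  refine LinearMap.finrank_le_finrank_of_injective (f := φ) ?_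
  rw [← LinearMap.ker_eq_bot, LinearMap.ker_eq_bot']
  rintro ⟨x, y⟩ h
  have h2 : f x + y = 0 := congrArg (fun p => (p.2 : W)) h
  have h1 : g (f x) - x + g y = 0 := congrArg (fun p => (p.1 : V)) h
  have h3 : g (f x) + g y = 0 := by rw [← map_add, h2, map_zero]
  have hx : (x : V) = 0 := by
    have h4 : g (f x) - x + g y = g (f x) + g y - x := by abel
    rw [h4, h3, zero_sub, neg_eq_zero] at h1
    exact h1
  rw [hx, map_zero, zero_add] at h2
  exact Prod.ext (Subtype.ext hx) (Subtype.ext h2)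

/-- Rank-nullity for a restricted to eM. -/
theorem idemRank_eq_add (M : FDMod k H) (a e : H) :
    M.idemRank e = Module.finrank k (LinearMap.range (M.ρ (a * e))) +
      Module.finrank k (LinearMap.ker (M.ρ a) ⊓ LinearMap.range (M.ρ e) : Submodule k M.carrier) := by
  let g := (M.ρ a).domRestrict (LinearMap.range (M.ρ e))
  have h1 : LinearMap.range g = LinearMap.range (M.ρ (a * e)) := by
    ext z
    constructor
    · rintro ⟨⟨_, y, rfl⟩, rfl⟩
      exact ⟨y, rho_mul_apply M a e y⟩
    · rintro ⟨y, rfl⟩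
      exact ⟨⟨_, y, rfl⟩, (rho_mul_apply M a e y).symm⟩
  have h2 : (LinearMap.ker g).map (LinearMap.range (M.ρ e)).subtype =
      LinearMap.ker (M.ρ a) ⊓ LinearMap.range (M.ρ e) := by
    ext z
    constructor
    · rintro ⟨⟨z, hz⟩, h0, rfl⟩
      exact ⟨h0, hz⟩
    · rintro ⟨h0, hz⟩
      exact ⟨⟨z, hz⟩, h0, rfl⟩
  have h3 := LinearMap.finrank_range_add_finrank_ker g
  rw [h1, ← Submodule.finrank_map_subtype_eq, h2] at h3
  exact h3.symm

/-- The e-part of the homology ker a / im a' of M has dimension at most that of N, if g ∘ f is the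
identity on the homology of M. The relation a'e' = ea' identifies the e-part of im a' with the image
of a'e'. -/
theorem finrank_ker_add_le {M N : FDMod k H} (f : M ⟶ N) (g : N ⟶ M) {a a' e e' : H}
    (he : e * e = e) (hae : a' * e' = e * a') (ha : a * a' = 0)
    (h : ∀ x, M.ρ a x = 0 → ∃ y, M.ρ a' y = Hom.toLin (f ≫ g) x - x) :
    Module.finrank k (LinearMap.ker (M.ρ a) ⊓ LinearMap.range (M.ρ e) : Submodule k M.carrier) +
      Module.finrank k (LinearMap.range (N.ρ (a' * e'))) ≤
    Module.finrank k (LinearMap.ker (N.ρ a) ⊓ LinearMap.range (N.ρ e) : Submodule k N.carrier) +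
      Module.finrank k (LinearMap.range (M.ρ (a' * e'))) := by
  refine finrank_add_le _ _ _ _ ?_ (Hom.toLin f) (Hom.toLin g) ?_ ?_ ?_
  · rintro _ ⟨y, rfl⟩
    refine ⟨?_, ?_⟩
    · change N.ρ a _ = 0
      rw [← rho_mul_apply, ← mul_assoc, ha, zero_mul, map_zero]; rfl
    · rw [hae, rho_mul_apply]; exact ⟨_, rfl⟩
  · rintro x ⟨h0, y, rfl⟩
    refine ⟨?_, ?_⟩
    · change N.ρ a _ = 0
      rw [← Hom.comm, LinearMap.mem_ker.1 h0, map_zero]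
    · rw [Hom.comm]; exact ⟨_, rfl⟩
  · rintro _ ⟨y, rfl⟩
    rw [Hom.comm]; exact ⟨_, rfl⟩
  · rintro x ⟨h0, hx⟩
    obtain ⟨y, hy⟩ := h x h0
    refine ⟨y, ?_⟩
    have h1 : M.ρ e x = x := (mem_range_rho_iff M he x).1 hx
    rw [hae, rho_mul_apply, hy, map_sub, h1, ← Hom.comm, h1]
    rfl

/-- A retract of a projective module is projective. -/
theorem IsProjective.of_retract {P Q : FDMod k H} (hP : P.IsProjective) (i : Q ⟶ P) (p : P ⟶ Q)
    (h : ∀ x, Hom.toLin p (Hom.toLin i x) = x) : Q.IsProjective := by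
  let _ : Module H P.carrier := Module.compHom P.carrier P.ρ.toRingHom
  let _ : Module H Q.carrier := Module.compHom Q.carrier Q.ρ.toRingHom
  let i' : Q.carrier →ₗ[H] P.carrier :=
    { toFun := Hom.toLin i, map_add' := map_add _, map_smul' := Hom.comm i }
  let p' : P.carrier →ₗ[H] Q.carrier :=
    { toFun := Hom.toLin p, map_add' := map_add _, map_smul' := Hom.comm p }
  have : Module.Projective H P.carrier := hP
  exact Module.Projective.of_split i' p' (LinearMap.ext h)

theorem isProjective_reg [Module.Finite k H] : (reg k H).IsProjective := by
  have h : Module.compHom (reg k H).carrier (reg k H).ρ.toRingHom =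
      (Semiring.toModule : Module H H) := by
    ext
    rfl
  unfold IsProjective
  rw [h]
  exact (inferInstance : Module.Projective H H)

theorem isProjective_of_subsingleton (P : FDMod k H) [Subsingleton P.carrier] :
    P.IsProjective := by
  let _ : Module H P.carrier := Module.compHom P.carrier P.ρ.toRingHom
  change Module.Projective H P.carrier
  exact ⟨⟨0, fun x => Subsingleton.elim _ _⟩⟩

/-- A section s of the map from the free module on the set P writes x as ∑ s(x)_p p. If a kills x,
it kills each coordinate s(x)_p, which is therefore a' y_p by exactness in H, and x = a' ∑ y_p p. -/
theorem IsProjective.exact {P : FDMod k H} (hP : P.IsProjective) {a a' : H}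
    (h : ∀ x : H, a * x = 0 → ∃ y, a' * y = x) (x : P.carrier) (hx : P.ρ a x = 0) :
    ∃ y, P.ρ a' y = x := by
  let _ : Module H P.carrier := Module.compHom P.carrier P.ρ.toRingHom
  have : Module.Projective H P.carrier := hP
  obtain ⟨s, hs⟩ := Module.Projective.out (R := H) (P := P.carrier)
  have h1 : ∀ p, ∃ y, a' * y = s x p := by
    intro p
    refine h _ ?_
    have h2 : s (a • x) = 0 := by
      rw [show a • x = 0 from hx, map_zero]
    rw [map_smul] at h2
    exact DFunLike.congr_fun h2 p
  choose y hy using h1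
  refine ⟨∑ p ∈ (s x).support, P.ρ (y p) p, ?_⟩
  rw [map_sum]
  conv_rhs => rw [← hs x, Finsupp.linearCombination_apply, Finsupp.sum]
  refine Finset.sum_congr rfl fun p _ => ?_
  rw [← rho_mul_apply, hy]
  rfl

/-- The homomorphism `H → M`, `h ↦ h x`. -/
noncomputable def orbit [Module.Finite k H] (M : FDMod k H) (x : M.carrier) : reg k H ⟶ M where
  toLin := LinearMap.applyₗ x ∘ₗ M.ρ.toLinearMap
  comm a h := rho_mul_apply M a h x

/-- The zero module. -/
noncomputable def zero (k H : Type u) [Field k] [Ring H] [Algebra k H] : FDMod k H where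
  carrier := PUnit
  ρ := AlgHom.ofLinearMap 0 (Subsingleton.elim _ _) fun _ _ => Subsingleton.elim _ _

instance : Subsingleton (zero k H).carrier := inferInstanceAs (Subsingleton PUnit)

/-- The zero homomorphism. -/
noncomputable def zeroHom (M N : FDMod k H) : M ⟶ N where
  toLin := 0
  comm h x := by simp

end Algebra

end FDMod

namespace Taft

open FDMod

/-! ### Strings, and exactness of X and X^(n-1) on projective modules -/

section Exactness

variable {k : Type u} [Field k] [CharZero k] {n : ℕ} [NeZero n] {ζ : k} {hn : 1 < n}
  {hζ : IsPrimitiveRoot ζ n}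

/-- A linear map that commutes with `K` and `X` is a homomorphism of modules. -/
def homOfGen {M N : FDMod k (TaftAlgebra hn hζ)} (f : M.carrier →ₗ[k] N.carrier)
    (hK : ∀ x, f (M.ρ (K hn hζ) x) = N.ρ (K hn hζ) (f x))
    (hX : ∀ x, f (M.ρ (X hn hζ) x) = N.ρ (X hn hζ) (f x)) : M ⟶ N where
  toLin := f
  comm h := mem_of_subalgebra hn hζ
    { carrier := {h | ∀ x, f (M.ρ h x) = N.ρ h (f x)}
      mul_mem' := fun {a b} ha hb x => by rw [rho_mul_apply, rho_mul_apply, ha, hb]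
      add_mem' := fun {a b} ha hb x => by
        rw [map_add, map_add, LinearMap.add_apply, LinearMap.add_apply, map_add, ha, hb]
      algebraMap_mem' := fun c x => by
        rw [AlgHom.commutes, AlgHom.commutes, Module.algebraMap_end_apply,
          Module.algebraMap_end_apply, map_smul] } hK hX h

/-- The diagonal operator `K` on the string of weight `i`. -/
noncomputable def stringK (hζ : IsPrimitiveRoot ζ n) (i : ZMod n) : Module.End k (Fin n → k) :=
  LinearMap.pi fun j => chi hζ (i + (j : ℕ)) • LinearMap.proj j

/-- The shift operator `X` on a string. -/
def stringX (k : Type u) [Field k] (n : ℕ) : Module.End k (Fin n → k) :=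
  LinearMap.pi fun j => if 0 < j.val then
    LinearMap.proj ⟨j.val - 1, (Nat.sub_le _ _).trans_lt j.isLt⟩ else 0

theorem stringK_apply (i : ZMod n) (f : Fin n → k) (j : Fin n) :
    stringK hζ i f j = chi hζ (i + (j : ℕ)) * f j := rfl

theorem stringX_pow_apply (m : ℕ) (f : Fin n → k) (j : Fin n) :
    (stringX k n ^ m) f j =
      if m ≤ j.val then f ⟨j.val - m, (Nat.sub_le _ _).trans_lt j.isLt⟩ else 0 := by
  induction m generalizing j with
  | zero => simp
  | succ m ih =>
    rw [pow_succ', Module.End.mul_apply, stringX, LinearMap.pi_apply]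
    by_cases hj : 0 < j.val
    · rw [if_pos hj, LinearMap.proj_apply, ← stringX, ih]
      by_cases hm : m + 1 ≤ j.val
      · rw [if_pos (show m ≤ j.val - 1 by omega), if_pos hm]
        congr 2
        simp only
        omega
      · rw [if_neg (show ¬ m ≤ j.val - 1 by omega), if_neg hm]
    · rw [if_neg hj, if_neg (by omega), LinearMap.zero_apply]

theorem stringX_apply (f : Fin n → k) (j : Fin n) :
    stringX k n f j =
      if 1 ≤ j.val then f ⟨j.val - 1, (Nat.sub_le _ _).trans_lt j.isLt⟩ else 0 := by
  rw [← stringX_pow_apply, pow_one]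

/-- The action of the Taft algebra on a string. -/
noncomputable def stringRho (hn : 1 < n) (hζ : IsPrimitiveRoot ζ n) (i : ZMod n) :
    TaftAlgebra hn hζ →ₐ[k] Module.End k (Fin n → k) :=
  lift hn hζ (stringK hζ i) (stringX k n)
    (by
      refine LinearMap.ext fun f => funext fun j => ?_
      rw [LinearMap.smul_apply, Pi.smul_apply, Module.End.mul_apply, Module.End.mul_apply,
        stringK_apply, stringX_apply, stringX_apply, stringK_apply]
      split_ifs with h
      · obtain ⟨m, hm⟩ : ∃ m, j.val = m + 1 := ⟨j.val - 1, by omega⟩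
        rw [smul_eq_mul, ← mul_assoc]
        congr 1
        -- Position j has weight one more than position j - 1; this supplies the factor ζ in KX =
        -- ζXK.
        have h' : i + ((j : ℕ) : ZMod n) = 1 + (i + ((j.val - 1 : ℕ) : ZMod n)) := by
          rw [hm, Nat.add_sub_cancel]
          push_cast
          ring
        rw [h', AddChar.map_add_eq_mul, chi_one]
      · simp)
    (by
      have h : ∀ (m : ℕ) (f : Fin n → k) (j : Fin n),
          (stringK hζ i ^ m) f j = chi hζ (i + (j : ℕ)) ^ m * f j := by
        intro m
        induction m with
        | zero => simp
        | succ m ih =>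
          intro f j
          rw [pow_succ', Module.End.mul_apply, stringK_apply, ih, pow_succ']
          ring
      refine LinearMap.ext fun f => funext fun j => ?_
      rw [h, ← AddChar.map_nsmul_eq_pow, nsmul_eq_mul, CharP.cast_eq_zero, zero_mul,
        AddChar.map_zero_eq_one, one_mul]
      rfl)
    (by
      refine LinearMap.ext fun f => funext fun j => ?_
      rw [stringX_pow_apply, if_neg (not_le.2 j.isLt)]
      rfl)

theorem stringRho_K (i : ZMod n) : stringRho hn hζ i (K hn hζ) = stringK hζ i := by
  rw [stringRho, lift_K]

theorem stringRho_X (i : ZMod n) : stringRho hn hζ i (X hn hζ) = stringX k n := by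
  rw [stringRho, lift_X]

/-- The indecomposable projective module with basis `w, Xw, …, X^(n-1) w`, where
`Kw = ζ ^ i w`. -/
noncomputable def stringMod (hn : 1 < n) (hζ : IsPrimitiveRoot ζ n) (i : ZMod n) :
    FDMod k (TaftAlgebra hn hζ) where
  carrier := Fin n → k
  ρ := stringRho hn hζ i

theorem rho_K_stringMod (i : ZMod n) : (stringMod hn hζ i).ρ (K hn hζ) = stringK hζ i :=
  stringRho_K i

theorem rho_X_stringMod (i : ZMod n) : (stringMod hn hζ i).ρ (X hn hζ) = stringX k n :=
  stringRho_X i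

theorem rho_X_pow_stringMod (i : ZMod n) (m : ℕ) :
    (stringMod hn hζ i).ρ (X hn hζ ^ m) = stringX k n ^ m := by
  refine (map_pow (stringRho hn hζ i) _ _).trans ?_
  rw [stringRho_X]

/-- The generator of the string. -/
def stringGen (hn : 1 < n) (hζ : IsPrimitiveRoot ζ n) (i : ZMod n) :
    (stringMod hn hζ i).carrier :=
  (Pi.single 0 1 : Fin n → k)

theorem weightIdem_stringGen (i : ZMod n) :
    (stringMod hn hζ i).ρ (weightIdem hn hζ i) (stringGen hn hζ i) = stringGen hn hζ i := by
  rw [rho_weightIdem_of_eigenvector hn hζ _ i i, if_pos rfl]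
  rw [rho_K_stringMod]
  refine funext fun j => ?_
  change chi hζ (i + (j : ℕ)) * (Pi.single 0 1 : Fin n → k) j =
    chi hζ i * (Pi.single 0 1 : Fin n → k) j
  by_cases hj : j = 0
  · rw [hj]; simp
  · rw [Pi.single_eq_of_ne hj, mul_zero, mul_zero]

theorem X_pow_stringGen (i : ZMod n) (j : Fin n) :
    (stringMod hn hζ i).ρ (X hn hζ ^ j.val) (stringGen hn hζ i) =
      (Pi.single j 1 : Fin n → k) := by
  rw [rho_X_pow_stringMod]
  refine funext fun l => ?_
  refine (stringX_pow_apply j.val (Pi.single 0 1) l).trans ?_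
  rw [Pi.single_apply, Pi.single_apply]
  by_cases h : j.val ≤ l.val
  · rw [if_pos h]
    congr 1
    rw [Fin.ext_iff, Fin.ext_iff, Fin.val_zero]
    exact propext ⟨fun h' => by simp only at h'; omega, fun h' => by simp only; omega⟩
  · rw [if_neg h, if_neg fun h' => h (by rw [h'])]

/-- The linear map that sends the basis of the string to the elements `X ^ j e_i`. -/
noncomputable def stringLin (hn : 1 < n) (hζ : IsPrimitiveRoot ζ n) (i : ZMod n) :
    (Fin n → k) →ₗ[k] TaftAlgebra hn hζ :=
  Fintype.linearCombination k fun j : Fin n => X hn hζ ^ j.val * weightIdem hn hζ i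

theorem stringLin_apply (i : ZMod n) (f : Fin n → k) :
    stringLin hn hζ i f = ∑ j : Fin n, f j • (X hn hζ ^ j.val * weightIdem hn hζ i) :=
  Fintype.linearCombination_apply ..

theorem stringLin_stringK (i : ZMod n) (f : Fin n → k) :
    stringLin hn hζ i (stringK hζ i f) = K hn hζ * stringLin hn hζ i f := by
  rw [stringLin_apply, stringLin_apply, Finset.mul_sum]
  refine Finset.sum_congr rfl fun j _ => ?_
  rw [mul_smul_comm, X_pow_mul_weightIdem, ← mul_assoc, K_mul_weightIdem, smul_mul_assoc,
    smul_smul, mul_comm, stringK_apply]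

theorem stringLin_stringX (i : ZMod n) (f : Fin n → k) :
    stringLin hn hζ i (stringX k n f) = X hn hζ * stringLin hn hζ i f := by
  rw [stringLin_apply, stringLin_apply, Finset.mul_sum]
  obtain ⟨m, rfl⟩ : ∃ m, n = m + 1 := ⟨n - 1, by omega⟩
  rw [Fin.sum_univ_succ, Fin.sum_univ_castSucc]
  have h1 : stringX k (m + 1) f 0 = 0 := by
    rw [stringX_apply, if_neg (by simp)]
  have h2 : ∀ j : Fin m, stringX k (m + 1) f j.succ = f j.castSucc := by
    intro j
    rw [stringX_apply, if_pos (by simp)]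
    rfl
  simp only [h1, h2, zero_smul, zero_add, mul_smul_comm, ← mul_assoc, ← pow_succ', Fin.val_last,
    X_pow, zero_mul, smul_zero, add_zero, Fin.val_succ, Fin.val_castSucc]

/-- The embedding of the string as the left ideal generated by an idempotent. -/
noncomputable def stringEmb (hn : 1 < n) (hζ : IsPrimitiveRoot ζ n) (i : ZMod n) :
    stringMod hn hζ i ⟶ reg k (TaftAlgebra hn hζ) :=
  homOfGen (M := stringMod hn hζ i) (N := reg k (TaftAlgebra hn hζ)) (stringLin hn hζ i)
    (fun f => by rw [rho_K_stringMod]; exact stringLin_stringK i f)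
    (fun f => by rw [rho_X_stringMod]; exact stringLin_stringX i f)

theorem stringEmb_gen (i : ZMod n) :
    Hom.toLin (stringEmb hn hζ i) (stringGen hn hζ i) = weightIdem hn hζ i := by
  refine (stringLin_apply i (Pi.single 0 1)).trans ?_
  rw [Finset.sum_eq_single 0]
  · simp
  · intro j _ hj
    rw [Pi.single_eq_of_ne hj, zero_smul]
  · exact fun h => absurd (Finset.mem_univ _) h

/-- The map h ↦ hw sends X^j e_i to X^j w, the j-th basis vector, so it splits the embedding and the
string is a direct summand of H. -/
theorem orbit_stringEmb (i : ZMod n) (f : (stringMod hn hζ i).carrier) :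
    Hom.toLin (orbit (stringMod hn hζ i) (stringGen hn hζ i)) (Hom.toLin (stringEmb hn hζ i) f) =
      f := by
  let f' : Fin n → k := f
  let p : TaftAlgebra hn hζ →ₗ[k] (Fin n → k) :=
    Hom.toLin (orbit (stringMod hn hζ i) (stringGen hn hζ i))
  change p (stringLin hn hζ i f') = f'
  have h : ∀ j : Fin n, p (X hn hζ ^ j.val * weightIdem hn hζ i) = Pi.single j 1 := by
    intro j
    refine (rho_mul_apply (stringMod hn hζ i) _ _ _).trans ?_
    rw [weightIdem_stringGen, X_pow_stringGen]
  rw [stringLin_apply, map_sum]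
  simp only [map_smul, h]
  exact (pi_eq_sum_univ' f').symm

theorem isProjective_stringMod (i : ZMod n) : (stringMod hn hζ i).IsProjective :=
  (isProjective_reg (k := k) (H := TaftAlgebra hn hζ)).of_retract (stringEmb hn hζ i) _
    (orbit_stringEmb i)

/-- Reduces exactness in H to strings: x = ∑ x e_i, where x e_i is the image in H of the vector x w
of the i-th string, and a kills x w when ax = 0. -/
theorem exact_reg {a a' : TaftAlgebra hn hζ}
    (h : ∀ (i : ZMod n) (x : (stringMod hn hζ i).carrier), (stringMod hn hζ i).ρ a x = 0 →
      ∃ y, (stringMod hn hζ i).ρ a' y = x) (x : TaftAlgebra hn hζ) (hx : a * x = 0) :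
    ∃ y, a' * y = x := by
  have h1 : ∀ i : ZMod n, ∃ y, (stringMod hn hζ i).ρ a' y =
      (stringMod hn hζ i).ρ x (stringGen hn hζ i) := by
    intro i
    refine h i _ ?_
    rw [← rho_mul_apply, hx, map_zero, LinearMap.zero_apply]
  choose y hy using h1
  refine ⟨∑ i, (show TaftAlgebra hn hζ from Hom.toLin (stringEmb hn hζ i) (y i)), ?_⟩
  rw [Finset.mul_sum]
  conv_rhs => rw [← mul_one x, ← sum_weightIdem, Finset.mul_sum]
  refine Finset.sum_congr rfl fun i _ => ?_
  refine (Hom.comm (stringEmb hn hζ i) a' (y i)).symm.trans ?_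
  rw [hy, Hom.comm, stringEmb_gen]
  rfl

/-- In a projective module, the kernel of `X` is the image of `X ^ (n - 1)`. -/
theorem exists_X_pow_pred {P : FDMod k (TaftAlgebra hn hζ)} (hP : P.IsProjective)
    (x : P.carrier) (hx : P.ρ (X hn hζ) x = 0) : ∃ y, P.ρ (X hn hζ ^ (n - 1)) y = x := by
  refine hP.exact (exact_reg fun i f hf => ?_) x hx
  rw [rho_X_stringMod] at hf
  rw [rho_X_pow_stringMod]
  let f' : Fin n → k := f
  -- X^(n-1) moves coordinate 0 to coordinate n - 1 and forgets the others, so only coordinate 0 of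
  -- the preimage matters and a constant sequence serves. The other coordinates of f vanish because
  -- Xf = 0: coordinate j + 1 of Xf is f_j.
  refine ⟨fun _ => f' ⟨n - 1, by omega⟩, funext fun j => ?_⟩
  refine (stringX_pow_apply (n - 1) _ j).trans ?_
  change _ = f' j
  by_cases hj : n - 1 ≤ j.val
  · rw [if_pos hj]
    congr 1
    exact Fin.ext (by simp only; omega)
  · rw [if_neg hj]
    have h := (stringX_apply f' ⟨j.val + 1, by omega⟩).symm.trans (congrFun hf ⟨j.val + 1, by omega⟩)
    rw [if_pos (by simp)] at h
    exact h.symm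

/-- In a projective module, the kernel of `X ^ (n - 1)` is the image of `X`. -/
theorem exists_X {P : FDMod k (TaftAlgebra hn hζ)} (hP : P.IsProjective)
    (x : P.carrier) (hx : P.ρ (X hn hζ ^ (n - 1)) x = 0) : ∃ y, P.ρ (X hn hζ) y = x := by
  refine hP.exact (exact_reg fun i f hf => ?_) x hx
  rw [rho_X_pow_stringMod] at hf
  rw [rho_X_stringMod]
  let f' : Fin n → k := f
  -- The preimage is f shifted back, with an arbitrary last coordinate, here 0. It works because
  -- f_0, the last coordinate of X^(n-1) f, is zero.
  refine ⟨fun j => if h : j.val + 1 < n then f' ⟨j.val + 1, h⟩ else 0, funext fun j => ?_⟩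
  refine (stringX_apply _ j).trans ?_
  change _ = f' j
  by_cases hj : 1 ≤ j.val
  · rw [if_pos hj, dif_pos (by simp only; omega)]
    congr 1
    exact Fin.ext (by simp only; omega)
  · rw [if_neg hj]
    have h := (stringX_pow_apply (n - 1) f' ⟨n - 1, by omega⟩).symm.trans
      (congrFun hf ⟨n - 1, by omega⟩)
    rw [if_pos (by simp)] at h
    rw [← h.trans (show (0 : Fin n → k) _ = 0 from rfl)]
    congr 1
    exact Fin.ext (by simp only; omega)

end Exactness

end Taft

/-! ### Homomorphisms up to their action on the homology ker a / im a' -/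

namespace FDMod

variable {k H : Type u} [Field k] [Ring H] [Algebra k H]

/-- Two homomorphisms are identified when their difference maps the kernel of `a` into the image
of `a'`. -/
def kerRel (a a' : H) : HomRel (FDMod k H) :=
  fun M N f g => ∀ x, M.ρ a x = 0 → ∃ y, N.ρ a' y = Hom.toLin f x - Hom.toLin g x

theorem comp_apply {X Y Z : FDMod k H} (f : X ⟶ Y) (g : Y ⟶ Z) (x : X.carrier) :
    Hom.toLin (f ≫ g) x = Hom.toLin g (Hom.toLin f x) := rfl

/-- Homomorphisms commute with a and a', so precomposition preserves ker a and postcomposition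
preserves im a'. -/
instance (a a' : H) : Congruence (kerRel (k := k) a a') where
  equivalence :=
    { refl := fun f x _ => ⟨0, by rw [map_zero, sub_self]⟩
      symm := fun {f g} h x hx => by
        obtain ⟨y, hy⟩ := h x hx
        exact ⟨-y, by rw [map_neg, hy, neg_sub]⟩
      trans := fun {f g l} h h' x hx => by
        obtain ⟨y, hy⟩ := h x hx
        obtain ⟨y', hy'⟩ := h' x hx
        exact ⟨y + y', by rw [map_add, hy, hy', sub_add_sub_cancel]⟩ }
  comp_left f g g' h x hx := by
    refine h (Hom.toLin f x) ?_
    rw [← Hom.comm, hx, map_zero]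
  comp_right {_ _ _ f f'} g h x hx := by
    obtain ⟨y, hy⟩ := h x hx
    exact ⟨Hom.toLin g y, by rw [← Hom.comm, hy, map_sub]; rfl⟩

/-- A map through a projective P carries ker a into the kernel of a on P, which is the image of a'
there, and then into im a'. -/
theorem kerRel_of_stableRel {a a' : H} (h : ∀ x : H, a * x = 0 → ∃ y, a' * y = x)
    {M N : FDMod k H} {f g : M ⟶ N} (hfg : stableRel k H f g) : kerRel a a' f g := by
  obtain ⟨P, b, c, hP, hbc⟩ := hfg
  intro x hx
  obtain ⟨y, hy⟩ := hP.exact h (Hom.toLin b x) (by rw [← Hom.comm, hx, map_zero])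
  refine ⟨Hom.toLin c y, ?_⟩
  rw [← Hom.comm, hy, ← LinearMap.sub_apply, hbc]
  rfl

end FDMod

namespace Taft

open FDMod

/-! ### Stable invariance of the character and its additivity on triangles -/

section StableInvariance

variable {k : Type u} [Field k] [CharZero k] {n : ℕ} [NeZero n] {ζ : k} {hn : 1 < n}
  {hζ : IsPrimitiveRoot ζ n}

/-- The quotient functor to the category modulo `kerRel` factors through the stable category.
Representatives of a stable isomorphism and of its inverse are therefore mutually inverse on
homology. -/
theorem exists_inverse_of_iso {a a' : TaftAlgebra hn hζ}
    (h : ∀ x : TaftAlgebra hn hζ, a * x = 0 → ∃ y, a' * y = x)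
    {M N : FDMod k (TaftAlgebra hn hζ)} (φ : StMod.of M ≅ StMod.of N) :
    ∃ (f : M ⟶ N) (g : N ⟶ M), kerRel a a' (f ≫ g) (𝟙 M) ∧ kerRel a a' (g ≫ f) (𝟙 N) := by
  let F : StMod k (TaftAlgebra hn hζ) ⥤ CategoryTheory.Quotient (kerRel (k := k) a a') :=
    CategoryTheory.Quotient.lift _ (CategoryTheory.Quotient.functor _)
      fun _ _ _ _ hfg => CategoryTheory.Quotient.sound _ (kerRel_of_stableRel h hfg)
  obtain ⟨f, hf⟩ := (CategoryTheory.Quotient.functor (stableRel k _)).map_surjective φ.hom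
  obtain ⟨g, hg⟩ := (CategoryTheory.Quotient.functor (stableRel k _)).map_surjective φ.inv
  refine ⟨f, g, ?_, ?_⟩
  · rw [← CategoryTheory.Quotient.functor_map_eq_iff (kerRel a a')]
    have h1 : (CategoryTheory.Quotient.functor (stableRel k _)).map (f ≫ g) =
        (CategoryTheory.Quotient.functor (stableRel k _)).map (𝟙 M) := by
      rw [Functor.map_comp, hf, hg, φ.hom_inv_id]
      rfl
    exact congrArg F.map h1
  · rw [← CategoryTheory.Quotient.functor_map_eq_iff (kerRel a a')]
    have h1 : (CategoryTheory.Quotient.functor (stableRel k _)).map (g ≫ f) =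
        (CategoryTheory.Quotient.functor (stableRel k _)).map (𝟙 N) := by
      rw [Functor.map_comp, hf, hg, φ.inv_hom_id]
      rfl
    exact congrArg F.map h1

theorem X_mul_X_pow_pred : X hn hζ * X hn hζ ^ (n - 1) = 0 := by
  rw [← pow_succ', Nat.sub_add_cancel hn.le, X_pow]

theorem X_pow_pred_mul_X : X hn hζ ^ (n - 1) * X hn hζ = 0 := by
  rw [← pow_succ, Nat.sub_add_cancel hn.le, X_pow]

/-- Modules that are isomorphic in the stable category have the same differences of consecutive
multiplicities. -/
theorem mult_add_mult_of_iso {M N : FDMod k (TaftAlgebra hn hζ)}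
    (φ : StMod.of M ≅ StMod.of N) (i : ZMod n) :
    mult M i + mult N (i + 1) = mult N i + mult M (i + 1) := by
  have hreg := isProjective_reg (k := k) (H := TaftAlgebra hn hζ)
  obtain ⟨f, g, hfg, hgf⟩ := exists_inverse_of_iso
    (fun x hx => exists_X_pow_pred (hn := hn) (hζ := hζ) hreg x hx) φ
  obtain ⟨f', g', hfg', hgf'⟩ := exists_inverse_of_iso
    (fun x hx => exists_X (hn := hn) (hζ := hζ) hreg x hx) φ
  -- Subtracting the expansions of m_i by X and of m_(i+1) by X^(n-1) groups the four terms into the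
  -- two homology dimensions. Each of these agrees for M and N by a pair of opposite inequalities.
  have h1 := idemRank_eq_add M (X hn hζ) (weightIdem hn hζ i)
  have h2 := idemRank_eq_add N (X hn hζ) (weightIdem hn hζ i)
  have h3 := idemRank_eq_add M (X hn hζ ^ (n - 1)) (weightIdem hn hζ (i + 1))
  have h4 := idemRank_eq_add N (X hn hζ ^ (n - 1)) (weightIdem hn hζ (i + 1))
  have h5 := finrank_ker_add_le f g (weightIdem_idem i) (X_pow_pred_mul_weightIdem hn hζ i)
    X_mul_X_pow_pred hfg
  have h6 := finrank_ker_add_le g f (weightIdem_idem i) (X_pow_pred_mul_weightIdem hn hζ i)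
    X_mul_X_pow_pred hgf
  have h7 := finrank_ker_add_le f' g' (weightIdem_idem (i + 1)) (X_mul_weightIdem hn hζ i)
    X_pow_pred_mul_X hfg'
  have h8 := finrank_ker_add_le g' f' (weightIdem_idem (i + 1)) (X_mul_weightIdem hn hζ i)
    X_pow_pred_mul_X hgf'
  change idemRank _ _ + idemRank _ _ = idemRank _ _ + idemRank _ _
  omega

theorem character_eq_of_iso {M N : FDMod k (TaftAlgebra hn hζ)}
    (φ : StMod.of M ≅ StMod.of N) : character M = character N :=
  character_eq_of_mult (mult_add_mult_of_iso φ)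

/-- A projective module is zero in the stable category. -/
noncomputable def isoZero {P : FDMod k (TaftAlgebra hn hζ)} (hP : P.IsProjective) :
    StMod.of P ≅ StMod.of (zero k (TaftAlgebra hn hζ)) where
  hom := StMod.res (zeroHom _ _)
  inv := StMod.res (zeroHom _ _)
  hom_inv_id := CategoryTheory.Quotient.sound _ ⟨P, 𝟙 P, ⟨-LinearMap.id, fun h x => by simp⟩, hP, by
    ext x
    exact zero_sub x⟩
  inv_hom_id := congrArg _ (Hom.ext (LinearMap.ext fun x => Subsingleton.elim (α := PUnit) _ _))

theorem mult_eq_zero_of_subsingleton (M : FDMod k (TaftAlgebra hn hζ))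
    [Subsingleton M.carrier] (i : ZMod n) : mult M i = 0 := by
  rw [mult, idemRank, Module.finrank_zero_of_subsingleton]

theorem character_eq_zero_of_subsingleton (M : FDMod k (TaftAlgebra hn hζ))
    [Subsingleton M.carrier] : character M = 0 :=
  Finset.sum_eq_zero fun i _ => by rw [mult_eq_zero_of_subsingleton, Nat.cast_zero, zero_mul]

/-- All eigenvalues of `K` on a projective module have the same multiplicity. -/
theorem mult_eq_of_isProjective {P : FDMod k (TaftAlgebra hn hζ)} (hP : P.IsProjective)
    (i : ZMod n) : mult P i = mult P 0 := by
  rw [← ZMod.natCast_zmod_val i]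
  induction i.val with
  | zero => rw [Nat.cast_zero]
  | succ j ih =>
    -- P is stably zero, and all multiplicities of the zero module are 0, so the consecutive
    -- multiplicities of P coincide.
    have h := mult_add_mult_of_iso (isoZero hP) (j : ZMod n)
    rw [mult_eq_zero_of_subsingleton (zero _ _), mult_eq_zero_of_subsingleton (zero _ _), add_zero,
      zero_add] at h
    rw [Nat.cast_succ, ← h, ih]

theorem character_eq_zero {P : FDMod k (TaftAlgebra hn hζ)} (hP : P.IsProjective) :
    character P = 0 := by
  rw [character_eq_of_iso (isoZero hP), character_eq_zero_of_subsingleton]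

/-- The component x ↦ -Λ ⊗ x is already injective: contract the first factor with a functional that
does not vanish on Λ ≠ 0. -/
theorem pushoutHom_injective (Λ : LeftIntegral k (TaftAlgebra hn hζ))
    {M N : FDMod k (TaftAlgebra hn hζ)} (u : M ⟶ N) :
    Function.Injective (Hom.toLin (StMod.pushoutHom Λ u)) := by
  rw [← LinearMap.ker_eq_bot, LinearMap.ker_eq_bot']
  intro x hx
  have h1 : -(StMod.vec Λ ⊗ₜ[k] x) = 0 := congrArg Prod.snd hx
  rw [neg_eq_zero] at h1
  obtain ⟨φ, hφ⟩ : ∃ φ : Module.Dual k (TaftAlgebra hn hζ), φ Λ.elem ≠ 0 := by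
    by_contra! h
    exact Λ.ne_zero ((Module.forall_dual_apply_eq_zero_iff k _).1 h)
  let F : TaftAlgebra hn hζ ⊗[k] M.carrier →ₗ[k] M.carrier :=
    (TensorProduct.lid k M.carrier).toLinearMap ∘ₗ LinearMap.rTensor M.carrier φ
  have h2 : φ Λ.elem • x = 0 := (congrArg F h1).trans (map_zero F)
  exact (smul_eq_zero.1 h2).resolve_left hφ

/-- Apply additivity to 0 → M → N ⊕ (H ⊗ M) → C_u → 0. The middle term H ⊗ M contributes
character(H) · character(M) = 0, by projectivity of H alone. -/
theorem character_cone (Λ : LeftIntegral k (TaftAlgebra hn hζ))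
    {M N : FDMod k (TaftAlgebra hn hζ)} (u : M ⟶ N) :
    character (StMod.cone Λ u) + character M = character N := by
  have h := character_coker _ (pushoutHom_injective Λ u)
  rw [character_prod, character_tensor, character_eq_zero isProjective_reg, zero_mul,
    add_zero] at h
  exact h

/-- Only the objects of the triangle matter: they are stably isomorphic to those of a standard one.
-/
theorem character_of_isDistinguished (Λ : LeftIntegral k (TaftAlgebra hn hζ))
    {A B C : StMod k (TaftAlgebra hn hζ)} {f : A ⟶ B} {g : B ⟶ C}
    {h : C ⟶ StMod.of (StMod.shift Λ A.as)} (hd : StMod.IsDistinguished Λ f g h) :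
    character B.as = character A.as + character C.as := by
  obtain ⟨X', Y', u, a, b, c, ha, -⟩ := hd
  rw [character_eq_of_iso (M := B.as) b, character_eq_of_iso (M := C.as) c,
    character_eq_of_iso (asIso (StMod.res a)), ← character_cone Λ u, add_comm]

/-- The character, as a homomorphism from the Grothendieck group. -/
noncomputable def characterHom (Λ : LeftIntegral k (TaftAlgebra hn hζ)) :
    StMod.GrothendieckGroup Λ →+ CyclicRing n :=
  QuotientAddGroup.lift _ (FreeAbelianGroup.lift fun A => character A.as) (by
    rw [AddSubgroup.closure_le]
    rintro _ ⟨A, B, C, f, g, h, hd, rfl⟩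
    change FreeAbelianGroup.lift _ _ = 0
    rw [map_sub, map_add, FreeAbelianGroup.lift_apply_of, FreeAbelianGroup.lift_apply_of,
      FreeAbelianGroup.lift_apply_of, character_of_isDistinguished Λ hd, sub_self])

theorem characterHom_cls (Λ : LeftIntegral k (TaftAlgebra hn hζ))
    (A : StMod k (TaftAlgebra hn hζ)) : characterHom Λ (StMod.cls Λ A) = character A.as :=
  FreeAbelianGroup.lift_apply_of _ _

end StableInvariance

end Taft

/-! ### Relations in the Grothendieck group from cones and cokernels -/

namespace StMod

open FDMod

variable {k H : Type u} [Field k] [Ring H] [HopfAlgebra k H] [Module.Finite k H]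
variable (Λ : LeftIntegral k H)

theorem shiftMap_id (M : FDMod k H) : shiftMap Λ (𝟙 M) = 𝟙 (shift Λ M) :=
  Hom.ext TensorProduct.map_id

theorem cls_eq_of_isDistinguished {A B C : StMod k H} {f : A ⟶ B} {g : B ⟶ C}
    {h : C ⟶ of (shift Λ A.as)} (hd : IsDistinguished Λ f g h) :
    cls Λ B = cls Λ A + cls Λ C := by
  refine sub_eq_zero.1 ((QuotientAddGroup.eq_zero_iff (FreeAbelianGroup.of B -
    (FreeAbelianGroup.of A + FreeAbelianGroup.of C))).2 (AddSubgroup.subset_closure ?_))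
  exact ⟨A, B, C, f, g, h, hd, rfl⟩

/-- The standard triangle of u, with its third object replaced along the isomorphism, is
distinguished. The first two components of the isomorphism of triangles are identities. -/
theorem cls_eq_of_cone_iso {M N C : FDMod k H} (u : M ⟶ N) (c : of C ≅ of (cone Λ u)) :
    cls Λ (of N) = cls Λ (of M) + cls Λ (of C) := by
  have h1 : res (𝟙 M) = 𝟙 (of M) := rfl
  refine cls_eq_of_isDistinguished Λ (f := res u) (g := res (coneIn Λ u) ≫ c.inv)
    (h := c.hom ≫ res (coneOut Λ u)) ⟨M, N, u, 𝟙 M, Iso.refl _, c, ?_, ?_, ?_, ?_⟩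
  · rw [h1]; infer_instance
  · rw [h1]
    exact (Category.comp_id _).trans (Category.id_comp _).symm
  · rw [Category.assoc, c.inv_hom_id]
    exact (Category.comp_id _).trans (Category.id_comp _).symm
  · rw [shiftMap_id]
    exact Category.comp_id _

/-- If the embedding `M → H ⊗ M` extends along `u : M → N`, then the map from `N` to the cone
of `u`. -/
noncomputable def toCone {M N : FDMod k H} (u : M ⟶ N) (r : N ⟶ tensor (reg k H) M) :
    N ⟶ cone Λ u where
  toLin := Hom.toLin (cokerMk (pushoutHom Λ u)) ∘ₗ LinearMap.prod LinearMap.id (-Hom.toLin r)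
  comm h x := by
    refine Eq.trans (congrArg (Hom.toLin (cokerMk (pushoutHom Λ u))) ?_)
      (Hom.comm (cokerMk (pushoutHom Λ u)) h (x, -Hom.toLin r x))
    exact Prod.ext rfl ((congrArg Neg.neg (Hom.comm r h x)).trans (map_neg _ _).symm)

/-- The projection from the cone of `u` to the cokernel of `u`. -/
noncomputable def coneToCoker {M N : FDMod k H} (u : M ⟶ N) : cone Λ u ⟶ coker u :=
  cokerDesc (pushoutHom Λ u)
    ⟨Hom.toLin (cokerMk u) ∘ₗ LinearMap.fst k N.carrier (tensor (reg k H) M).carrier,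
      fun h x => Hom.comm (cokerMk u) h x.1⟩
    fun x => (Submodule.Quotient.mk_eq_zero _).2 ⟨x, rfl⟩

/-- The map from the cone of `u` to `H ⊗ M` induced by an extension `r` of `M → H ⊗ M`. -/
noncomputable def coneRetract {M N : FDMod k H} (u : M ⟶ N) (r : N ⟶ tensor (reg k H) M)
    (hr : ∀ x, Hom.toLin r (Hom.toLin u x) = Hom.toLin (embed Λ M) x) :
    cone Λ u ⟶ tensor (reg k H) M :=
  cokerDesc (pushoutHom Λ u)
    ⟨LinearMap.coprod (Hom.toLin r) LinearMap.id, fun h x => by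
      change Hom.toLin r (N.ρ h x.1) + (tensor (reg k H) M).ρ h x.2 =
        (tensor (reg k H) M).ρ h (Hom.toLin r x.1 + x.2)
      rw [Hom.comm, map_add]⟩
    fun x => by
      change Hom.toLin r (Hom.toLin u x) + -Hom.toLin (embed Λ M) x = 0
      rw [hr, add_neg_cancel]

/-- The map `H ⊗ M → C_u`, `z ↦ (0, -z)`. -/
noncomputable def tensorToCone {M N : FDMod k H} (u : M ⟶ N) : tensor (reg k H) M ⟶ cone Λ u where
  toLin := Hom.toLin (cokerMk (pushoutHom Λ u)) ∘ₗ
    LinearMap.inr k N.carrier (tensor (reg k H) M).carrier ∘ₗ (-LinearMap.id)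
  comm h x := by
    refine Eq.trans (congrArg (Hom.toLin (cokerMk (pushoutHom Λ u))) ?_)
      (Hom.comm (cokerMk (pushoutHom Λ u)) h (0, -x))
    exact Prod.ext (map_zero (N.ρ h)).symm (map_neg ((tensor (reg k H) M).ρ h) x).symm

/-- If the embedding `M → H ⊗ M` extends along `u`, then the cone of `u` is stably isomorphic
to the cokernel of `u`. -/
noncomputable def cokerIsoCone {M N : FDMod k H} (u : M ⟶ N) (r : N ⟶ tensor (reg k H) M)
    (hr : ∀ x, Hom.toLin r (Hom.toLin u x) = Hom.toLin (embed Λ M) x)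
    (hP : (tensor (reg k H) M).IsProjective) : of (coker u) ≅ of (cone Λ u) where
  hom := res (cokerDesc u (toCone Λ u r) fun x => by
    -- Since r extends the embedding, (u(x), -r(u(x))) = (u(x), -Λ ⊗ x), which is zero in the cone.
    refine (Submodule.Quotient.mk_eq_zero _).2 ⟨x, ?_⟩
    exact Prod.ext rfl (congrArg Neg.neg (hr x).symm))
  inv := res (coneToCoker Λ u)
  hom_inv_id := congrArg _ (Hom.ext (LinearMap.ext fun x => by
    obtain ⟨y, rfl⟩ := Submodule.Quotient.mk_surjective _ x
    rfl))
  -- The composite C_u → N / u(M) → C_u sends [(y, e)] to [(y, -r(y))]. It differs from the identity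
  -- by [(0, -(r(y) + e))], which factors through H ⊗ M.
  inv_hom_id := CategoryTheory.Quotient.sound _ ⟨tensor (reg k H) M, coneRetract Λ u r hr,
    tensorToCone Λ u, hP, LinearMap.ext fun x => by
      obtain ⟨⟨y, e⟩, rfl⟩ := Submodule.Quotient.mk_surjective _ x
      refine (map_sub (Hom.toLin (cokerMk (pushoutHom Λ u))) (y, -Hom.toLin r y) (y, e)).symm.trans
        (congrArg (Hom.toLin (cokerMk (pushoutHom Λ u))) ?_)
      refine Prod.ext (sub_self y) ?_
      change -Hom.toLin r y - e = -(Hom.toLin r y + e)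
      abel⟩

end StMod

namespace Taft

open FDMod

/-! ### One-dimensional modules and their tensor products with H -/

section Generators

variable {k : Type u} [Field k] [CharZero k] {n : ℕ} [NeZero n] {ζ : k} {hn : 1 < n}
  {hζ : IsPrimitiveRoot ζ n}

theorem chi_pow_n (i : ZMod n) : chi hζ i ^ n = 1 := by
  rw [← AddChar.map_nsmul_eq_pow, nsmul_eq_mul, CharP.cast_eq_zero, zero_mul,
    AddChar.map_zero_eq_one]

/-- The character `K ↦ ζ ^ i`, `X ↦ 0` of the Taft algebra. -/
noncomputable def oneDimHom (hn : 1 < n) (hζ : IsPrimitiveRoot ζ n) (i : ZMod n) :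
    TaftAlgebra hn hζ →ₐ[k] k :=
  lift hn hζ (chi hζ i) 0 (by simp) (chi_pow_n i) (zero_pow (zero_lt_one.trans hn).ne')

/-- The one-dimensional module on which `K` acts by `ζ ^ i` and `X` by `0`. -/
noncomputable def oneDim (hn : 1 < n) (hζ : IsPrimitiveRoot ζ n) (i : ZMod n) :
    FDMod k (TaftAlgebra hn hζ) where
  carrier := k
  ρ := (Algebra.lmul k k).comp (oneDimHom hn hζ i)

theorem rho_K_oneDim (i : ZMod n) (c : (oneDim hn hζ i).carrier) :
    (oneDim hn hζ i).ρ (K hn hζ) c = chi hζ i • c := by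
  change oneDimHom hn hζ i (K hn hζ) * (show k from c) = chi hζ i * (show k from c)
  rw [oneDimHom, lift_K]

theorem rho_X_oneDim (i : ZMod n) (c : (oneDim hn hζ i).carrier) :
    (oneDim hn hζ i).ρ (X hn hζ) c = 0 := by
  change oneDimHom hn hζ i (X hn hζ) * (show k from c) = (0 : k)
  rw [oneDimHom, lift_X, zero_mul]

/-- Each weight idempotent acts as 0 or 1, so its trace is 0 or the dimension. -/
theorem mult_of_scalar (M : FDMod k (TaftAlgebra hn hζ)) (i : ZMod n)
    (h : ∀ x, M.ρ (K hn hζ) x = chi hζ i • x) (a : ZMod n) :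
    mult M a = if a = i then Module.finrank k M.carrier else 0 := by
  apply Nat.cast_injective (R := k)
  have h2 : M.ρ (weightIdem hn hζ a) = if a = i then 1 else 0 := by
    ext x
    rw [rho_weightIdem_of_eigenvector hn hζ M a i (h x)]
    split_ifs <;> rfl
  rw [cast_mult, h2]
  split_ifs
  · exact LinearMap.trace_one _ _
  · rw [map_zero, Nat.cast_zero]

/-- The character of a module on which `K` acts by a scalar. -/
theorem character_of_scalar (M : FDMod k (TaftAlgebra hn hζ)) (i : ZMod n)
    (h : ∀ x, M.ρ (K hn hζ) x = chi hζ i • x) :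
    character M = Module.finrank k M.carrier * qChar n i := by
  rw [character, Finset.sum_eq_single i]
  · rw [mult_of_scalar M i h, if_pos rfl]
  · intro a _ ha
    rw [mult_of_scalar M i h, if_neg ha, Nat.cast_zero, zero_mul]
  · exact fun h => absurd (Finset.mem_univ _) h

theorem finrank_oneDim (i : ZMod n) : Module.finrank k (oneDim hn hζ i).carrier = 1 :=
  Module.finrank_self k

theorem mult_oneDim (i a : ZMod n) : mult (oneDim hn hζ i) a = if a = i then 1 else 0 := by
  rw [mult_of_scalar _ i (rho_K_oneDim i), finrank_oneDim]

theorem character_oneDim (i : ZMod n) : character (oneDim hn hζ i) = qChar n i := by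
  rw [character_of_scalar _ i (rho_K_oneDim i), finrank_oneDim, Nat.cast_one, one_mul]

theorem character_unit : character (unit k (TaftAlgebra hn hζ)) = 1 := by
  rw [character_of_scalar _ 0]
  · have : Module.finrank k (unit k (TaftAlgebra hn hζ)).carrier = 1 := Module.finrank_self k
    rw [this, Nat.cast_one, one_mul, AddChar.map_zero_eq_one]
  · intro c
    change counit (R := k) (K hn hζ) * (show k from c) = chi hζ 0 * (show k from c)
    rw [counit_K, AddChar.map_zero_eq_one]

theorem rho_K_tensor (M N : FDMod k (TaftAlgebra hn hζ)) (x : M.carrier) (y : N.carrier) :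
    (tensor M N).ρ (K hn hζ) (x ⊗ₜ[k] y) = M.ρ (K hn hζ) x ⊗ₜ[k] N.ρ (K hn hζ) y := by
  change tensorAct M N (comul (R := k) (K hn hζ)) (x ⊗ₜ[k] y) = _
  rw [comul_K, tensorAct_tmul]

theorem rho_X_tensor (M N : FDMod k (TaftAlgebra hn hζ)) (x : M.carrier) (y : N.carrier) :
    (tensor M N).ρ (X hn hζ) (x ⊗ₜ[k] y) =
      M.ρ (X hn hζ) x ⊗ₜ[k] y + M.ρ (K hn hζ) x ⊗ₜ[k] N.ρ (X hn hζ) y := by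
  change tensorAct M N (comul (R := k) (X hn hζ)) (x ⊗ₜ[k] y) = _
  rw [comul_X, map_add, LinearMap.add_apply, tensorAct_tmul, tensorAct_tmul, map_one]
  rfl

/-- The automorphism `K ↦ ζ ^ i K`, `X ↦ X` of the Taft algebra. -/
noncomputable def twist (hn : 1 < n) (hζ : IsPrimitiveRoot ζ n) (i : ZMod n) :
    TaftAlgebra hn hζ →ₐ[k] TaftAlgebra hn hζ :=
  lift hn hζ (chi hζ i • K hn hζ) (X hn hζ)
    (by rw [smul_mul_assoc, mul_smul_comm, K_mul_X, smul_comm])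
    (by rw [smul_pow, chi_pow_n, K_pow, one_smul]) (X_pow hn hζ)

theorem twist_K (i : ZMod n) : twist hn hζ i (K hn hζ) = chi hζ i • K hn hζ := by
  rw [twist, lift_K]

theorem twist_X (i : ZMod n) : twist hn hζ i (X hn hζ) = X hn hζ := by
  rw [twist, lift_X]

/-- The vector space map `H ⊗ k → H`, `h ⊗ c ↦ c α(h)`, where `α` is the twist. -/
noncomputable def twistLin (hn : 1 < n) (hζ : IsPrimitiveRoot ζ n) (i : ZMod n) :
    TaftAlgebra hn hζ ⊗[k] k →ₗ[k] TaftAlgebra hn hζ :=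
  (TensorProduct.rid k (TaftAlgebra hn hζ)).toLinearMap ∘ₗ
    LinearMap.rTensor k (twist hn hζ (-i)).toLinearMap

theorem twistLin_tmul (i : ZMod n) (h : TaftAlgebra hn hζ) (c : k) :
    twistLin hn hζ i (h ⊗ₜ[k] c) = c • twist hn hζ (-i) h := rfl

/-- The tensor product of the regular module and a one-dimensional module. -/
noncomputable abbrev regTensor (hn : 1 < n) (hζ : IsPrimitiveRoot ζ n) (i : ZMod n) :
    FDMod k (TaftAlgebra hn hζ) :=
  tensor (reg k (TaftAlgebra hn hζ)) (oneDim hn hζ i)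

/-- The pure tensor `h ⊗ c`. -/
noncomputable def pureTensor (i : ZMod n) (h : TaftAlgebra hn hζ) (c : k) :
    (regTensor hn hζ i).carrier :=
  h ⊗ₜ[k] c

theorem rho_K_pureTensor (i : ZMod n) (h : TaftAlgebra hn hζ) (c : k) :
    (regTensor hn hζ i).ρ (K hn hζ) (pureTensor i h c) =
      pureTensor i (K hn hζ * h) (chi hζ i * c) := by
  refine (rho_K_tensor (reg k (TaftAlgebra hn hζ)) (oneDim hn hζ i) h c).trans ?_
  exact congrArg (TensorProduct.mk k (reg k (TaftAlgebra hn hζ)).carrier (oneDim hn hζ i).carrier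
    (K hn hζ * h)) (rho_K_oneDim i c)

theorem rho_X_pureTensor (i : ZMod n) (h : TaftAlgebra hn hζ) (c : k) :
    (regTensor hn hζ i).ρ (X hn hζ) (pureTensor i h c) = pureTensor i (X hn hζ * h) c := by
  refine (rho_X_tensor (reg k (TaftAlgebra hn hζ)) (oneDim hn hζ i) h c).trans ?_
  have h0 : TensorProduct.mk k (reg k (TaftAlgebra hn hζ)).carrier (oneDim hn hζ i).carrier
      (K hn hζ * h) ((oneDim hn hζ i).ρ (X hn hζ) c) = 0 :=
    (congrArg _ (rho_X_oneDim i c)).trans (map_zero _)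
  exact (congrArg (fun z : (regTensor hn hζ i).carrier => pureTensor i (X hn hζ * h) c + z)
    h0).trans (add_zero _)

theorem regTensor_linearMap_ext {i : ZMod n} {V : Type*} [AddCommGroup V] [Module k V]
    {f g : (regTensor hn hζ i).carrier →ₗ[k] V}
    (h : ∀ x c, f (pureTensor i x c) = g (pureTensor i x c)) : f = g :=
  TensorProduct.ext' h

/-- The isomorphism from the tensor product of the regular module and a one-dimensional module
to the regular module. -/
noncomputable def twistHom (hn : 1 < n) (hζ : IsPrimitiveRoot ζ n) (i : ZMod n) :
    regTensor hn hζ i ⟶ reg k (TaftAlgebra hn hζ) :=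
  homOfGen (M := regTensor hn hζ i) (N := reg k (TaftAlgebra hn hζ)) (twistLin hn hζ i)
    (LinearMap.congr_fun (f := (twistLin hn hζ i) ∘ₗ (regTensor hn hζ i).ρ (K hn hζ))
      (g := (LinearMap.mulLeft k (K hn hζ)) ∘ₗ (twistLin hn hζ i))
      (regTensor_linearMap_ext fun h c => by
        change twistLin hn hζ i ((regTensor hn hζ i).ρ (K hn hζ) (pureTensor i h c)) =
          K hn hζ * (c • twist hn hζ (-i) h)
        rw [rho_K_pureTensor]
        refine (twistLin_tmul i _ _).trans ?_
        rw [map_mul, twist_K, smul_mul_assoc, smul_smul, mul_smul_comm, mul_right_comm,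
          chi_mul_neg, one_mul]))
    (LinearMap.congr_fun (f := (twistLin hn hζ i) ∘ₗ (regTensor hn hζ i).ρ (X hn hζ))
      (g := (LinearMap.mulLeft k (X hn hζ)) ∘ₗ (twistLin hn hζ i))
      (regTensor_linearMap_ext fun h c => by
        change twistLin hn hζ i ((regTensor hn hζ i).ρ (X hn hζ) (pureTensor i h c)) =
          X hn hζ * (c • twist hn hζ (-i) h)
        rw [rho_X_pureTensor]
        refine (twistLin_tmul i _ _).trans ?_
        rw [map_mul, twist_X, mul_smul_comm]))

theorem smul_pureTensor (i : ZMod n) (a : k) (h : TaftAlgebra hn hζ) (c : k) :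
    a • pureTensor i h c = pureTensor i h (a * c) :=
  (TensorProduct.tmul_smul (R := k) a (show (reg k (TaftAlgebra hn hζ)).carrier from h)
    (show (oneDim hn hζ i).carrier from c)).symm

/-- The twist replaces K by ζ^(-i) K, cancelling the scalar ζ^i by which K acts on the
one-dimensional factor. It suffices to check this on the generators K and X. -/
theorem rho_twist_pureTensor (i : ZMod n) (h h' : TaftAlgebra hn hζ) (c : k) :
    (regTensor hn hζ i).ρ (twist hn hζ (-i) h) (pureTensor i h' c) = pureTensor i (h * h') c := by
  revert h' c
  refine mem_of_subalgebra hn hζ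
    { carrier := {h | ∀ (h' : TaftAlgebra hn hζ) (c : k),
        (regTensor hn hζ i).ρ (twist hn hζ (-i) h) (pureTensor i h' c) = pureTensor i (h * h') c}
      mul_mem' := fun {a b} ha hb h' c => by
        rw [map_mul, rho_mul_apply, hb, ha, mul_assoc]
      add_mem' := fun {a b} ha hb h' c => by
        rw [map_add, map_add, LinearMap.add_apply, ha, hb, add_mul]
        exact (TensorProduct.add_tmul _ _ _).symm
      algebraMap_mem' := fun a h' c => by
        rw [AlgHom.commutes, AlgHom.commutes, Module.algebraMap_end_apply, ← Algebra.smul_def]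
        rfl } ?_ ?_ h
  · intro h' c
    rw [twist_K, map_smul, LinearMap.smul_apply, rho_K_pureTensor, smul_pureTensor, ← mul_assoc,
      mul_comm (chi hζ (-i)), chi_mul_neg, one_mul]
  · intro h' c
    rw [twist_X, rho_X_pureTensor]

/-- The map h ⊗ c ↦ c · twist(h) to H is undone by the orbit map of 1 ⊗ 1, so H ⊗ S_i is a retract
of H. -/
theorem isProjective_regTensor (i : ZMod n) : (regTensor hn hζ i).IsProjective := by
  refine (isProjective_reg (k := k) (H := TaftAlgebra hn hζ)).of_retract (twistHom hn hζ i)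
    (orbit _ (pureTensor i 1 1)) (LinearMap.congr_fun
      (f := Hom.toLin (orbit _ (pureTensor i 1 1)) ∘ₗ Hom.toLin (twistHom hn hζ i))
      (g := LinearMap.id) (regTensor_linearMap_ext fun h c => ?_))
  change (regTensor hn hζ i).ρ (c • twist hn hζ (-i) h) (pureTensor i 1 1) = pureTensor i h c
  rw [map_smul, LinearMap.smul_apply, rho_twist_pureTensor, mul_one,
    smul_pureTensor, mul_one]

end Generators

end Taft

namespace Taft

open FDMod

/-! ### The classes of one-dimensional modules generate -/

section Generation

variable {k : Type u} [Field k] [CharZero k] {n : ℕ} [NeZero n] {ζ : k} {hn : 1 < n}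
  {hζ : IsPrimitiveRoot ζ n}

theorem K_mul_X_pow (j : ℕ) :
    K hn hζ * X hn hζ ^ j = chi hζ j • (X hn hζ ^ j * K hn hζ) := by
  induction j with
  | zero => simp
  | succ j ih =>
    rw [pow_succ, ← mul_assoc, ih, smul_mul_assoc, mul_assoc, K_mul_X, mul_smul_comm, smul_smul,
      ← mul_assoc, Nat.cast_succ, AddChar.map_add_eq_mul, chi_one]

theorem rho_X_pow_rho_K (M : FDMod k (TaftAlgebra hn hζ)) (j : ℕ) (x : M.carrier) :
    M.ρ (X hn hζ ^ j) (M.ρ (K hn hζ) x) =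
      chi hζ (-j) • M.ρ (K hn hζ) (M.ρ (X hn hζ ^ j) x) := by
  rw [← rho_mul_apply, ← rho_mul_apply, K_mul_X_pow, map_smul, LinearMap.smul_apply, smul_smul,
    mul_comm, chi_mul_neg, one_smul]

theorem rho_K_X_pow_of_eigenvector (M : FDMod k (TaftAlgebra hn hζ)) (i : ZMod n) (j : ℕ)
    {x : M.carrier} (hx : M.ρ (K hn hζ) x = chi hζ i • x) :
    M.ρ (K hn hζ) (M.ρ (X hn hζ ^ j) x) = chi hζ (i + j) • M.ρ (X hn hζ ^ j) x := by
  have h := rho_X_pow_rho_K M j x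
  rw [hx, map_smul] at h
  rw [AddChar.map_add_eq_mul, mul_comm, mul_smul, h, smul_smul, chi_mul_neg, one_smul]

theorem weightIdem_mul_K (i : ZMod n) :
    weightIdem hn hζ i * K hn hζ = chi hζ i • weightIdem hn hζ i := by
  rw [← K_mul_weightIdem, weightIdem, mul_smul_comm, smul_mul_assoc, Finset.mul_sum, Finset.sum_mul]
  congr 1
  refine Finset.sum_congr rfl fun j _ => ?_
  rw [mul_smul_comm, smul_mul_assoc, ← Kpow_one, ← Kpow_add, ← Kpow_add, add_comm]

/-- The homomorphism `x ↦ ∑ j, φ(X^j x) X^(n-1-j) w` given by an eigenvector `w` of `K` and a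
functional `φ` that is an eigenvector of the transpose of `K`. -/
noncomputable def functionalHom (M E : FDMod k (TaftAlgebra hn hζ)) (i : ZMod n)
    (φ : M.carrier →ₗ[k] k) (hφ : ∀ x, φ (M.ρ (K hn hζ) x) = chi hζ i * φ x) (w : E.carrier)
    (hw : E.ρ (K hn hζ) w = chi hζ (i + 1) • w) : M ⟶ E :=
  homOfGen (∑ j ∈ Finset.range n,
      (φ ∘ₗ M.ρ (X hn hζ ^ j)).smulRight (E.ρ (X hn hζ ^ (n - 1 - j)) w))
    (fun x => by
      rw [LinearMap.sum_apply, LinearMap.sum_apply, map_sum]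
      refine Finset.sum_congr rfl fun j hj => ?_
      have hj' : j < n := Finset.mem_range.1 hj
      rw [LinearMap.smulRight_apply, LinearMap.smulRight_apply, map_smul,
        rho_K_X_pow_of_eigenvector E (i + 1) _ hw, LinearMap.comp_apply, LinearMap.comp_apply,
        rho_X_pow_rho_K, map_smul, hφ, smul_smul, smul_eq_mul]
      -- X^(n-1-j) w has weight (i + 1) + (n - 1 - j) = i - j in ℤ/n, matching the weight shift of φ
      -- ∘ X^j.
      have h : i + 1 + ((n - 1 - j : ℕ) : ZMod n) = -(j : ZMod n) + i := by
        rw [Nat.cast_sub (by omega), Nat.cast_sub (by omega), CharP.cast_eq_zero]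
        push_cast
        ring
      rw [h, AddChar.map_add_eq_mul]
      congr 1
      ring)
    (fun x => by
      rw [LinearMap.sum_apply, LinearMap.sum_apply, map_sum]
      obtain ⟨m, rfl⟩ : ∃ m, n = m + 1 := ⟨n - 1, by omega⟩
      -- On one side the last term contains X^n applied to x, on the other the first term contains
      -- X^n w. Both vanish, and the remaining terms match after a shift of j by one.
      rw [Finset.sum_range_succ, Finset.sum_range_succ']
      simp only [LinearMap.smulRight_apply, LinearMap.comp_apply, map_smul, ← rho_mul_apply,
        ← pow_succ, ← pow_succ', X_pow, map_zero, LinearMap.zero_apply, zero_smul, add_zero,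
        Nat.add_sub_cancel, Nat.sub_zero, smul_zero]
      refine Finset.sum_congr rfl fun j hj => ?_
      have hj' : j < m := Finset.mem_range.1 hj
      congr 4
      omega)

/-- Only the term j = 0 of the sum survives. -/
theorem functionalHom_apply_of_X_eq_zero (M E : FDMod k (TaftAlgebra hn hζ)) (i : ZMod n)
    (φ : M.carrier →ₗ[k] k) (hφ : ∀ x, φ (M.ρ (K hn hζ) x) = chi hζ i * φ x) (w : E.carrier)
    (hw : E.ρ (K hn hζ) w = chi hζ (i + 1) • w) {x : M.carrier} (hx : M.ρ (X hn hζ) x = 0) :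
    Hom.toLin (functionalHom M E i φ hφ w hw) x = φ x • E.ρ (X hn hζ ^ (n - 1)) w := by
  refine (LinearMap.sum_apply _ _ _).trans ?_
  rw [Finset.sum_eq_single 0]
  · rw [LinearMap.smulRight_apply, pow_zero, map_one]
    rfl
  · intro j _ hj
    obtain ⟨m, rfl⟩ := Nat.exists_eq_succ_of_ne_zero hj
    rw [LinearMap.smulRight_apply, LinearMap.comp_apply, pow_succ, rho_mul_apply, hx, map_zero,
      map_zero, zero_smul]
  · exact fun h => absurd (Finset.mem_range.2 (zero_lt_one.trans hn)) h

variable (Λ : LeftIntegral k (TaftAlgebra hn hζ))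

/-- The embedding of a one-dimensional module in its tensor product with `H` extends along
injective homomorphisms. -/
theorem exists_extension {M : FDMod k (TaftAlgebra hn hζ)} (i : ZMod n) (u : oneDim hn hζ i ⟶ M)
    (hu : Function.Injective (Hom.toLin u)) :
    ∃ r : M ⟶ regTensor hn hζ i,
      ∀ x, Hom.toLin r (Hom.toLin u x) = Hom.toLin (StMod.embed Λ (oneDim hn hζ i)) x := by
  let one : (oneDim hn hζ i).carrier := (1 : k)
  let t : (regTensor hn hζ i).carrier := Hom.toLin (StMod.embed Λ (oneDim hn hζ i)) one
  -- X kills t = Λ ⊗ 1 because it kills the generator of S_i, so exactness in the projective module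
  -- H ⊗ S_i gives t = X^(n-1) w.
  obtain ⟨w, hw⟩ := exists_X_pow_pred (isProjective_regTensor i) t (by
    rw [← Hom.comm, rho_X_oneDim, map_zero])
  obtain ⟨p, hp⟩ := (Hom.toLin u).exists_leftInverse_of_injective (LinearMap.ker_eq_bot.2 hu)
  -- A linear left inverse of u, composed with the projection onto weight i so that φ ∘ K = ζ^i φ.
  let φ : M.carrier →ₗ[k] k := (show M.carrier →ₗ[k] k from p) ∘ₗ M.ρ (weightIdem hn hζ i)
  have hφ : ∀ x, φ (M.ρ (K hn hζ) x) = chi hζ i * φ x := by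
    intro x
    change (show M.carrier →ₗ[k] k from p) (M.ρ (weightIdem hn hζ i) (M.ρ (K hn hζ) x)) = _
    rw [← rho_mul_apply, weightIdem_mul_K, map_smul, LinearMap.smul_apply, map_smul]
    rfl
  let r := functionalHom M (regTensor hn hζ i) i φ hφ
    ((regTensor hn hζ i).ρ (weightIdem hn hζ (i + 1)) w) (rho_K_rho_weightIdem hn hζ _ _ _)
  -- The vector w may be replaced by its component of weight i + 1: X^(n-1) e_(i+1) = e_i X^(n-1),
  -- and t has weight i.
  have hr : (regTensor hn hζ i).ρ (X hn hζ ^ (n - 1))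
      ((regTensor hn hζ i).ρ (weightIdem hn hζ (i + 1)) w) = t := by
    rw [← rho_mul_apply, X_pow_pred_mul_weightIdem, rho_mul_apply, hw, ← Hom.comm,
      rho_weightIdem_of_eigenvector hn hζ _ i i (rho_K_oneDim i one), if_pos rfl]
  refine ⟨r, fun x => ?_⟩
  let c : k := x
  have hx : x = c • one := (mul_one c).symm
  have h1 : φ (Hom.toLin u one) = 1 := by
    change (show M.carrier →ₗ[k] k from p) (M.ρ (weightIdem hn hζ i) (Hom.toLin u one)) = 1
    rw [← Hom.comm, rho_weightIdem_of_eigenvector hn hζ _ i i (rho_K_oneDim i one), if_pos rfl]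
    exact LinearMap.congr_fun hp one
  have h2 : Hom.toLin r (Hom.toLin u one) = t := by
    refine (functionalHom_apply_of_X_eq_zero _ _ _ _ _ _ _ ?_).trans ?_
    · rw [← Hom.comm, rho_X_oneDim, map_zero]
    · rw [h1, one_smul, hr]
  rw [hx, map_smul, map_smul, map_smul, h2]

theorem cls_eq_oneDim_add {M : FDMod k (TaftAlgebra hn hζ)} (i : ZMod n) (u : oneDim hn hζ i ⟶ M)
    (hu : Function.Injective (Hom.toLin u)) :
    StMod.cls Λ (StMod.of M) =
      StMod.cls Λ (StMod.of (oneDim hn hζ i)) + StMod.cls Λ (StMod.of (coker u)) := by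
  obtain ⟨r, hr⟩ := exists_extension Λ i u hu
  exact StMod.cls_eq_of_cone_iso Λ u (StMod.cokerIsoCone Λ u r hr (isProjective_regTensor i))

/-- P is stably zero, hence stably isomorphic to the cone of the identity of S_0, and the resulting
triangle gives [S_0] = [S_0] + [P]. -/
theorem cls_eq_zero {P : FDMod k (TaftAlgebra hn hζ)} (hP : P.IsProjective) :
    StMod.cls Λ (StMod.of P) = 0 := by
  let S := oneDim hn hζ 0
  obtain ⟨r, hr⟩ := exists_extension Λ 0 (𝟙 S) Function.injective_id
  have hs : Subsingleton (coker (𝟙 S)).carrier := by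
    refine Submodule.Quotient.subsingleton_iff.2 (LinearMap.range_eq_top.2 fun x => ⟨x, rfl⟩)
  have h := StMod.cls_eq_of_cone_iso Λ (𝟙 S) (isoZero hP ≪≫
    (isoZero (isProjective_of_subsingleton (coker (𝟙 S)))).symm ≪≫
    StMod.cokerIsoCone Λ (𝟙 S) r hr (isProjective_regTensor 0))
  exact left_eq_add.1 h

/-- A nonzero module contains a one-dimensional submodule. -/
theorem exists_oneDim_injective (M : FDMod k (TaftAlgebra hn hζ)) [Nontrivial M.carrier] :
    ∃ (i : ZMod n) (u : oneDim hn hζ i ⟶ M), Function.Injective (Hom.toLin u) := by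
  -- X is nilpotent on a nonzero space, so it has a kernel. Some weight component of a kernel vector
  -- is nonzero, and it is still killed by X.
  obtain ⟨x, hx0, hx⟩ : ∃ x, x ≠ 0 ∧ M.ρ (X hn hζ) x = 0 := by
    by_contra! h
    have h1 : ∀ (j : ℕ) (x : M.carrier), x ≠ 0 → M.ρ (X hn hζ ^ j) x ≠ 0 := by
      intro j
      induction j with
      | zero => intro x hx; simpa using hx
      | succ j ih =>
        intro x hx
        rw [pow_succ, rho_mul_apply]
        exact ih _ fun h0 => h x hx h0
    obtain ⟨x, hx⟩ := exists_ne (0 : M.carrier)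
    exact h1 n x hx (by rw [X_pow, map_zero, LinearMap.zero_apply])
  obtain ⟨i, hi⟩ : ∃ i, M.ρ (weightIdem hn hζ i) x ≠ 0 := by
    by_contra! h
    apply hx0
    have h1 : M.ρ 1 x = x := by rw [map_one]; rfl
    rw [← h1, ← sum_weightIdem hn hζ, map_sum, LinearMap.sum_apply]
    exact Finset.sum_eq_zero fun i _ => h i
  let v := M.ρ (weightIdem hn hζ i) x
  have hK : M.ρ (K hn hζ) v = chi hζ i • v := rho_K_rho_weightIdem hn hζ M i x
  have hX : M.ρ (X hn hζ) v = 0 := by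
    rw [← rho_mul_apply, X_mul_weightIdem, rho_mul_apply, hx, map_zero]
  let l : (oneDim hn hζ i).carrier →ₗ[k] M.carrier := LinearMap.toSpanSingleton k M.carrier v
  refine ⟨i, homOfGen l (fun c => ?_) (fun c => ?_), ?_⟩
  · rw [rho_K_oneDim, map_smul]
    change _ = M.ρ (K hn hζ) ((show k from c) • v)
    rw [map_smul, hK, smul_comm]
    rfl
  · rw [rho_X_oneDim, map_zero]
    change _ = M.ρ (X hn hζ) ((show k from c) • v)
    rw [map_smul, hX, smul_zero]
  · exact smul_left_injective k hi

theorem finrank_coker_oneDim {M : FDMod k (TaftAlgebra hn hζ)} (i : ZMod n)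
    (u : oneDim hn hζ i ⟶ M) (hu : Function.Injective (Hom.toLin u)) :
    Module.finrank k (coker u).carrier + 1 = Module.finrank k M.carrier := by
  have h := Submodule.finrank_quotient_add_finrank (LinearMap.range (Hom.toLin u))
  rw [LinearMap.finrank_range_of_inj hu, finrank_oneDim] at h
  exact h

/-- In the Grothendieck group a module is the sum of its composition factors. -/
theorem cls_eq_sum (M : FDMod k (TaftAlgebra hn hζ)) :
    StMod.cls Λ (StMod.of M) = ∑ i, mult M i • StMod.cls Λ (StMod.of (oneDim hn hζ i)) := by
  induction h : Module.finrank k M.carrier generalizing M with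
  | zero =>
    have : Subsingleton M.carrier := Module.finrank_zero_iff.1 h
    rw [cls_eq_zero Λ (isProjective_of_subsingleton M)]
    refine (Finset.sum_eq_zero fun i _ => ?_).symm
    rw [mult_eq_zero_of_subsingleton, zero_smul]
  | succ d ih =>
    have : Nontrivial M.carrier := Module.nontrivial_of_finrank_eq_succ h
    obtain ⟨i, u, hu⟩ := exists_oneDim_injective M
    have h1 := finrank_coker_oneDim i u hu
    rw [cls_eq_oneDim_add Λ i u hu, ih (coker u) (by omega)]
    have h2 : ∀ a, mult M a = mult (coker u) a + mult (oneDim hn hζ i) a := fun a =>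
      (idemRank_coker u hu (weightIdem_idem a)).symm
    simp only [h2, add_smul, Finset.sum_add_distrib, mult_oneDim, ite_smul, one_smul, zero_smul,
      Finset.sum_ite_eq', Finset.mem_univ, if_true]
    rw [add_comm]

end Generation

end Taft

/-! ### Uniqueness of the ring structure -/

namespace StMod

open FDMod

variable {k H : Type u} [Field k] [Ring H] [HopfAlgebra k H] [Module.Finite k H]
variable {Λ : LeftIntegral k H}

theorem mem_of_cls_mem (S : AddSubgroup (GrothendieckGroup Λ)) (h : ∀ A, cls Λ A ∈ S)
    (x : GrothendieckGroup Λ) : x ∈ S := by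
  obtain ⟨x, rfl⟩ := QuotientAddGroup.mk_surjective x
  induction x using FreeAbelianGroup.induction_on with
  | zero => exact S.zero_mem
  | of A => exact h A
  | neg A hA => exact S.neg_mem hA
  | add x y hx hy => exact S.add_mem hx hy

theorem hom_ext {B : Type*} [AddCommGroup B] {f g : GrothendieckGroup Λ →+ B}
    (h : ∀ A, f (cls Λ A) = g (cls Λ A)) : f = g :=
  AddMonoidHom.ext (mem_of_cls_mem (f.eqLocus g) h)

/-- Biadditive operations that agree on classes of modules are equal. -/
theorem eq_of_biadditive {m m' : GrothendieckGroup Λ → GrothendieckGroup Λ → GrothendieckGroup Λ}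
    (hl : ∀ x y z, m x (y + z) = m x y + m x z) (hr : ∀ x y z, m (x + y) z = m x z + m y z)
    (hl' : ∀ x y z, m' x (y + z) = m' x y + m' x z)
    (hr' : ∀ x y z, m' (x + y) z = m' x z + m' y z)
    (h : ∀ A B, m (cls Λ A) (cls Λ B) = m' (cls Λ A) (cls Λ B)) : m = m' := by
  have h1 : ∀ A y, m (cls Λ A) y = m' (cls Λ A) y := fun A =>
    DFunLike.congr_fun (hom_ext (f := AddMonoidHom.mk' (m (cls Λ A)) (hl _))
      (g := AddMonoidHom.mk' (m' (cls Λ A)) (hl' _)) (h A))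
  exact funext fun x => funext fun y => DFunLike.congr_fun
    (hom_ext (f := AddMonoidHom.mk' (fun x => m x y) fun _ _ => hr _ _ _)
      (g := AddMonoidHom.mk' (fun x => m' x y) fun _ _ => hr' _ _ _) fun A => h1 A y) x

/-- A ring structure r carries its own addition; distributivity is restated here for the given
addition, so that two such structures can be compared as biadditive operations. -/
theorem IsGrothendieckRing.mul_add {r : Ring (GrothendieckGroup Λ)} (h : IsGrothendieckRing Λ r)
    (x y z : GrothendieckGroup Λ) : r.mul x ((groupStructure Λ).add y z) =
      (groupStructure Λ).add (r.mul x y) (r.mul x z) :=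
  (congrArg (r.mul x) (h.add_eq y z).symm).trans ((r.left_distrib x y z).trans (h.add_eq _ _))

theorem IsGrothendieckRing.add_mul {r : Ring (GrothendieckGroup Λ)} (h : IsGrothendieckRing Λ r)
    (x y z : GrothendieckGroup Λ) : r.mul ((groupStructure Λ).add x y) z =
      (groupStructure Λ).add (r.mul x z) (r.mul y z) :=
  (congrArg (fun w => r.mul w z) (h.add_eq x y).symm).trans
    ((r.right_distrib x y z).trans (h.add_eq _ _))

/-- There is at most one ring structure with the prescribed products of classes. -/
theorem IsGrothendieckRing.unique {r r' : Ring (GrothendieckGroup Λ)}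
    (h : IsGrothendieckRing Λ r) (h' : IsGrothendieckRing Λ r') : r = r' := by
  refine Ring.ext (funext fun x => funext fun y => (h.add_eq x y).trans (h'.add_eq x y).symm)
    (eq_of_biadditive h.mul_add h.add_mul h'.mul_add h'.add_mul fun A B => ?_)
  exact (h.mul_eq A.as B.as).trans (h'.mul_eq A.as B.as).symm

end StMod

namespace Taft

open FDMod

/-! ### The isomorphism with ℤ[q] / (1 + q + ⋯ + q^(n-1)) -/

section Isomorphism

variable {k : Type u} [Field k] [CharZero k] {n : ℕ} [NeZero n] {ζ : k} {hn : 1 < n}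
  {hζ : IsPrimitiveRoot ζ n} (Λ : LeftIntegral k (TaftAlgebra hn hζ))

/-- The string is projective, so its n multiplicities are equal; their sum is its dimension n. -/
theorem mult_stringMod (i : ZMod n) : mult (stringMod hn hζ 0) i = 1 := by
  have h := mult_eq_of_isProjective (isProjective_stringMod (hn := hn) (hζ := hζ) 0)
  have h1 : Module.finrank k (stringMod hn hζ 0).carrier = n := Module.finrank_fin_fun k
  have h2 := sum_mult (stringMod hn hζ 0)
  simp only [h, h1, Finset.sum_const, Finset.card_univ, ZMod.card, smul_eq_mul] at h2
  rw [h]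
  exact Nat.eq_of_mul_eq_mul_left (zero_lt_one.trans hn) (h2.trans (mul_one n).symm)

theorem sum_cls_oneDim : ∑ i, StMod.cls Λ (StMod.of (oneDim hn hζ i)) = 0 := by
  rw [← cls_eq_zero Λ (isProjective_stringMod 0), cls_eq_sum]
  simp only [mult_stringMod, one_smul]

/-- The homomorphism from polynomials to the Grothendieck group that sends `q ^ i` to the class of
the one-dimensional module on which `K` acts by `ζ ^ i`. -/
noncomputable def polyHom : Polynomial ℤ →ₗ[ℤ] StMod.GrothendieckGroup Λ :=
  (Polynomial.basisMonomials ℤ).constr ℤ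
    fun i : ℕ => StMod.cls Λ (StMod.of (oneDim hn hζ (i : ZMod n)))

theorem polyHom_X_pow (i : ℕ) :
    polyHom Λ (Polynomial.X ^ i) = StMod.cls Λ (StMod.of (oneDim hn hζ (i : ZMod n))) := by
  have h := (Polynomial.basisMonomials ℤ).constr_basis ℤ
    (fun i : ℕ => StMod.cls Λ (StMod.of (oneDim hn hζ (i : ZMod n)))) i
  rw [Polynomial.coe_basisMonomials] at h
  exact (congrArg (polyHom Λ) (Polynomial.monomial_one_right_eq_X_pow i).symm).trans h

/-- Multiplication of 1 + q + ⋯ + q^(n-1) by q^a only permutes the classes [S_i] in the image, whose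
sum is zero. -/
theorem polyHom_mul_geomSum (p : Polynomial ℤ) :
    polyHom Λ (p * ∑ i ∈ Finset.range n, Polynomial.X ^ i) = 0 := by
  induction p using Polynomial.induction_on' with
  | add p q hp hq => rw [add_mul, map_add, hp, hq, add_zero]
  | monomial a c =>
    rw [← Polynomial.smul_X_eq_monomial, smul_mul_assoc, map_smul, Finset.mul_sum, map_sum]
    simp only [← pow_add, polyHom_X_pow, Nat.cast_add]
    rw [← sum_zmod_eq_sum_range
      fun i => StMod.cls Λ (StMod.of (oneDim hn hζ ((a : ZMod n) + i))),
      Fintype.sum_equiv (Equiv.addLeft (a : ZMod n))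
        (fun i => StMod.cls Λ (StMod.of (oneDim hn hζ ((a : ZMod n) + i))))
        (fun i => StMod.cls Λ (StMod.of (oneDim hn hζ i))) fun i => rfl,
      sum_cls_oneDim, smul_zero]

theorem characterHom_polyHom (p : Polynomial ℤ) :
    characterHom Λ (polyHom Λ p) = Ideal.Quotient.mk _ p := by
  induction p using Polynomial.induction_on' with
  | add p q hp hq => rw [map_add, map_add, map_add, hp, hq]
  | monomial a c =>
    rw [← Polynomial.smul_X_eq_monomial, map_smul, map_zsmul, polyHom_X_pow, characterHom_cls,
      character_oneDim, qChar_natCast, map_zsmul, map_pow]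
    rfl

theorem polyHom_surjective : Function.Surjective (polyHom Λ) := by
  refine StMod.mem_of_cls_mem (polyHom Λ).toAddMonoidHom.range fun A => ?_
  refine ⟨∑ i : ZMod n, mult A.as i • Polynomial.X ^ i.val, ?_⟩
  refine Eq.trans ?_ (cls_eq_sum Λ A.as).symm
  refine (map_sum (polyHom Λ) _ _).trans (Finset.sum_congr rfl fun i _ => ?_)
  rw [map_nsmul, polyHom_X_pow, ZMod.natCast_zmod_val]

/-- Every class comes from a polynomial p, and its character is p modulo the ideal. If that is zero,
p is a multiple of the geometric sum, which `polyHom` kills. -/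
theorem characterHom_bijective : Function.Bijective (characterHom Λ) := by
  constructor
  · rw [injective_iff_map_eq_zero]
    intro x hx
    obtain ⟨p, rfl⟩ := polyHom_surjective Λ x
    rw [characterHom_polyHom, Ideal.Quotient.eq_zero_iff_mem] at hx
    obtain ⟨c, rfl⟩ := Ideal.mem_span_singleton'.1 hx
    exact polyHom_mul_geomSum Λ c
  · intro y
    obtain ⟨p, rfl⟩ := Ideal.Quotient.mk_surjective y
    exact ⟨polyHom Λ p, characterHom_polyHom Λ p⟩

/-- The character, as an isomorphism of groups. -/
noncomputable def characterEquiv : StMod.GrothendieckGroup Λ ≃+ CyclicRing n :=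
  AddEquiv.ofBijective (characterHom Λ) (characterHom_bijective Λ)

/-- The ring structure carried over from `ℤ[q] / (1 + q + ⋯ + q^(n-1))`. -/
noncomputable abbrev grothendieckRing : Ring (StMod.GrothendieckGroup Λ) :=
  (characterEquiv Λ).toEquiv.ring

/-- Each axiom is checked after applying the injective character, where it becomes additivity,
character(k) = 1, or multiplicativity for ⊗. -/
theorem isGrothendieckRing : StMod.IsGrothendieckRing Λ (grothendieckRing Λ) where
  add_eq x y := by
    change (characterEquiv Λ).symm (characterEquiv Λ x + characterEquiv Λ y) = x + y
    rw [← map_add, AddEquiv.symm_apply_apply]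
  one_eq := by
    change (characterEquiv Λ).symm 1 = _
    rw [AddEquiv.symm_apply_eq]
    exact ((characterHom_cls Λ _).trans character_unit).symm
  mul_eq M N := by
    change (characterEquiv Λ).symm (characterEquiv Λ _ * characterEquiv Λ _) = _
    rw [AddEquiv.symm_apply_eq]
    have h : ∀ A, characterEquiv Λ (StMod.cls Λ A) = character A.as := characterHom_cls Λ
    rw [h, h, h, character_tensor]

end Isomorphism

end Taft

theorem mainTheorem8 {k : Type u} [Field k] [CharZero k] {n : ℕ} (hn : 1 < n) {ζ : k}
    (hζ : IsPrimitiveRoot ζ n) (Λ : LeftIntegral k (TaftAlgebra hn hζ)) :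
    (∃! r : Ring (StMod.GrothendieckGroup Λ), StMod.IsGrothendieckRing Λ r) ∧
    ∀ r : Ring (StMod.GrothendieckGroup Λ), StMod.IsGrothendieckRing Λ r →
      Nonempty (StMod.GrothendieckGroup Λ ≃+*
        (Polynomial ℤ ⧸ Ideal.span {∑ i ∈ Finset.range n, (Polynomial.X : Polynomial ℤ) ^ i})) := by
  have : NeZero n := ⟨(zero_lt_one.trans hn).ne'⟩
  have hr := Taft.isGrothendieckRing Λ
  refine ⟨⟨_, hr, fun r h => h.unique hr⟩, fun r h => ?_⟩
  -- By uniqueness r is the transported structure, for which the character is a ring isomorphism by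
  -- construction.
  obtain rfl := h.unique hr
  exact ⟨(Taft.characterEquiv Λ).toEquiv.ringEquiv⟩
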